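/- Equip the first Heisenberg group $\mathbf H=\mathbf R^3$, with group operation $(x,y,z)(x',y',z')=(x+x',\,y+y',\,z+z'+2(xy'-yx'))$, with the left-invariant metric $d(p,q)=\|p^{-1}q\|$, where $\|(x,y,z)\|=((x^2+y^2)^2+z^2)^{1/4}$. For $p\in\mathbf H$ and a pair $r=(r_1,r_2)$ of positive numbers, let the closed rectangle centred at $p$ be $$R(p,r)=p\cdot\{(x,y,z):\ x^2+y^2\le r_1^2,\ |z|\le r_2^2\}.$$ For $t\in[0,4]$ define the directed singular value function as follows: if $r_1\le r_2$, $$\Phi^t(r)=\begin{cases} r_2^t & \text{if } t\in[0,2],\\ r_1^{t-2}r_2^2 & \text{if } t\in[2,4],\end{cases}$$ and if $r_1\ge r_2$, $$\Phi^t(r)=\begin{cases} r_1^t & \text{if } t\in[0,3],\\ r_1^{6-t}r_2^{2(t-3)} & \text{if } t\in[3,4].\end{cases}$$ **Theorem.** Let $(r_n)$ be a bounded sequence of pairs of positive numbers and let $W\subset\mathbf H$ be a non-empty bounded open set. Let $\lambda$ be Lebesgue measure on $\mathbf R^3$, let $\lambda_W=\lambda(W)^{-1}\lambda|_W$ be the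 uniform distribution on $W$, and let $\mathbf P=\lambda_W^{\mathbf N}$ be the product measure on $\mathbf H^{\mathbf N}$. Then for $\mathbf P$-almost every sequence $(p_n)$, the Hausdorff dimension of the limsup set with respect to $d$ satisfies $$\dim_{\mathrm H}\bigcap_{n=1}^\infty\bigcup_{k=n}^\infty R(p_k,r_k)=\min\Big(4,\ \inf\Big\{t\in[0,4]:\ \sum_n\Phi^t(r_n)<\infty\Big\}\Big),$$ where $\inf\emptyset=+\infty$ and $\dim_{\mathrm H}\emptyset=0$. -/

import Mathlib

open MeasureTheory

/-- The underlying set `ℝ³` of the first Heisenberg group. -/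
@[ext]
structure Heisenberg where
  x : ℝ
  y : ℝ
  z : ℝ

namespace Heisenberg

instance : Mul Heisenberg :=
  ⟨fun p q => ⟨p.x + q.x, p.y + q.y, p.z + q.z + 2 * (p.x * q.y - p.y * q.x)⟩⟩

instance : One Heisenberg := ⟨⟨0, 0, 0⟩⟩

instance : Inv Heisenberg := ⟨fun p => ⟨-p.x, -p.y, -p.z⟩⟩

@[simp] theorem mul_x (p q : Heisenberg) : (p * q).x = p.x + q.x := rfl
@[simp] theorem mul_y (p q : Heisenberg) : (p * q).y = p.y + q.y := rfl
@[simp] theorem mul_z (p q : Heisenberg) :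
    (p * q).z = p.z + q.z + 2 * (p.x * q.y - p.y * q.x) := rfl
@[simp] theorem one_x : (1 : Heisenberg).x = 0 := rfl
@[simp] theorem one_y : (1 : Heisenberg).y = 0 := rfl
@[simp] theorem one_z : (1 : Heisenberg).z = 0 := rfl
@[simp] theorem inv_x (p : Heisenberg) : p⁻¹.x = -p.x := rfl
@[simp] theorem inv_y (p : Heisenberg) : p⁻¹.y = -p.y := rfl
@[simp] theorem inv_z (p : Heisenberg) : p⁻¹.z = -p.z := rfl

instance : Group Heisenberg :=
  Group.ofLeftAxioms
    (fun p q r => by ext <;> (simp; ring))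
    (fun p => by ext <;> simp)
    (fun p => by ext <;> simp; ring)

/-- The homogeneous norm `‖p‖ = ((x² + y²)² + z²)^{1/4}`. -/
noncomputable def gauge (p : Heisenberg) : ℝ :=
  ((p.x ^ 2 + p.y ^ 2) ^ 2 + p.z ^ 2) ^ (1 / 4 : ℝ)

theorem gauge_nonneg (p : Heisenberg) : 0 ≤ p.gauge := by
  unfold gauge; positivity

theorem gauge_pow_four (p : Heisenberg) :
    p.gauge ^ 4 = (p.x ^ 2 + p.y ^ 2) ^ 2 + p.z ^ 2 := by
  unfold gauge
  rw [← Real.rpow_natCast, ← Real.rpow_mul (by positivity)]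
  norm_num

theorem gauge_inv (p : Heisenberg) : p⁻¹.gauge = p.gauge := by
  simp [gauge]

theorem gauge_one : (1 : Heisenberg).gauge = 0 := by
  simp [gauge]

theorem eq_one_of_gauge_eq_zero {p : Heisenberg} (h : p.gauge = 0) : p = 1 := by
  have h4 := p.gauge_pow_four
  rw [h] at h4
  have hz : p.z = 0 := by nlinarith [sq_nonneg (p.x ^ 2 + p.y ^ 2), sq_nonneg p.z]
  have hxy : p.x ^ 2 + p.y ^ 2 = 0 := by
    nlinarith [sq_nonneg (p.x ^ 2 + p.y ^ 2), sq_nonneg p.z]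
  ext
  · simp only [one_x]; nlinarith [sq_nonneg p.x, sq_nonneg p.y]
  · simp only [one_y]; nlinarith [sq_nonneg p.x, sq_nonneg p.y]
  · simpa using hz

theorem gauge_sq_eq_norm (p : Heisenberg) :
    p.gauge ^ 2 = ‖(⟨p.x ^ 2 + p.y ^ 2, p.z⟩ : ℂ)‖ := by
  have h : (p.gauge ^ 2) ^ 2 = ‖(⟨p.x ^ 2 + p.y ^ 2, p.z⟩ : ℂ)‖ ^ 2 := by
    rw [← pow_mul, gauge_pow_four, Complex.sq_norm, Complex.normSq_mk]; ring
  exact (pow_left_inj₀ (sq_nonneg _) (norm_nonneg _) two_ne_zero).1 h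

theorem norm_horizontal_le (p : Heisenberg) : ‖(⟨p.x, p.y⟩ : ℂ)‖ ≤ p.gauge := by
  have h : ‖(⟨p.x, p.y⟩ : ℂ)‖ ^ 4 ≤ p.gauge ^ 4 := by
    rw [gauge_pow_four, show (4 : ℕ) = 2 * 2 from rfl, pow_mul, Complex.sq_norm,
      Complex.normSq_mk]
    nlinarith [sq_nonneg p.z]
  exact le_of_pow_le_pow_left₀ (by norm_num) p.gauge_nonneg h

theorem gauge_mul_le (p q : Heisenberg) : (p * q).gauge ≤ p.gauge + q.gauge := by
  have key : (p * q).gauge ^ 2 ≤ (p.gauge + q.gauge) ^ 2 := by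
    rw [gauge_sq_eq_norm]
    have e : (⟨(p * q).x ^ 2 + (p * q).y ^ 2, (p * q).z⟩ : ℂ) =
        ⟨p.x ^ 2 + p.y ^ 2, p.z⟩ + ⟨q.x ^ 2 + q.y ^ 2, q.z⟩ +
          2 * ((starRingEnd ℂ) ⟨p.x, p.y⟩ * ⟨q.x, q.y⟩) := by
      apply Complex.ext <;> simp <;> ring
    rw [e]
    refine (norm_add_le _ _).trans ((add_le_add_left (norm_add_le _ _) _).trans ?_)
    rw [← gauge_sq_eq_norm, ← gauge_sq_eq_norm, norm_mul, norm_mul, RCLike.norm_conj,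
      Complex.norm_ofNat]
    have := mul_le_mul p.norm_horizontal_le q.norm_horizontal_le (norm_nonneg _) p.gauge_nonneg
    nlinarith
  exact le_of_pow_le_pow_left₀ two_ne_zero
    (add_nonneg p.gauge_nonneg q.gauge_nonneg) key

/-- The left-invariant Heisenberg metric `d(p, q) = ‖p⁻¹ q‖`. The topology of `Heisenberg` is
the one induced by this metric. -/
noncomputable instance : MetricSpace Heisenberg where
  dist p q := (p⁻¹ * q).gauge
  dist_self p := by simp [gauge_one]
  dist_comm p q := by
    rw [← gauge_inv (p⁻¹ * q)]; simp
  dist_triangle p q r := by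
    have := gauge_mul_le (p⁻¹ * q) (q⁻¹ * r)
    simpa [mul_assoc] using this
  eq_of_dist_eq_zero {p q} h := by
    exact inv_mul_eq_one.1 (eq_one_of_gauge_eq_zero h)

theorem dist_def (p q : Heisenberg) : dist p q = (p⁻¹ * q).gauge := rfl

/-- `Heisenberg` is identified with Euclidean `ℝ³` through the coordinates; the Heisenberg metric
induces the Euclidean topology. -/
noncomputable def coordinates : Heisenberg ≃ₜ ℝ × ℝ × ℝ where
  toFun p := (p.x, p.y, p.z)
  invFun v := ⟨v.1, v.2.1, v.2.2⟩
  left_inv _ := rfl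
  right_inv _ := rfl
  continuous_toFun := by
    have hx : Continuous (fun p : Heisenberg => p.x) := by
      refine (LipschitzWith.of_dist_le' (K := 1) fun p q => ?_).continuous
      have := (Complex.abs_re_le_norm _).trans (p⁻¹ * q).norm_horizontal_le
      rw [dist_def, one_mul, Real.dist_eq, abs_sub_comm]
      simpa [neg_add_eq_sub] using this
    have hy : Continuous (fun p : Heisenberg => p.y) := by
      refine (LipschitzWith.of_dist_le' (K := 1) fun p q => ?_).continuous
      have := (Complex.abs_im_le_norm _).trans (p⁻¹ * q).norm_horizontal_le
      rw [dist_def, one_mul, Real.dist_eq, abs_sub_comm]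
      simpa [neg_add_eq_sub] using this
    have hz : Continuous (fun p : Heisenberg => p.z) := by
      rw [continuous_iff_continuousAt]
      intro p
      have h0 : Filter.Tendsto (fun q : Heisenberg => (p⁻¹ * q).z) (nhds p) (nhds 0) := by
        have hd : Filter.Tendsto (fun q : Heisenberg => dist p q ^ 2) (nhds p) (nhds 0) := by
          have : Continuous fun q : Heisenberg => dist p q ^ 2 := by fun_prop
          simpa using this.tendsto p
        refine squeeze_zero_norm (fun q => ?_) hd
        rw [dist_def, gauge_sq_eq_norm]
        exact Complex.abs_im_le_norm (⟨_, (p⁻¹ * q).z⟩ : ℂ)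
      have h1 : Filter.Tendsto (fun q : Heisenberg => p.z + 2 * (p.x * q.y - p.y * q.x))
          (nhds p) (nhds p.z) := by
        have : Continuous fun q : Heisenberg => p.z + 2 * (p.x * q.y - p.y * q.x) := by fun_prop
        have h := this.tendsto p
        rwa [show p.z + 2 * (p.x * p.y - p.y * p.x) = p.z by ring] at h
      have h2 := h0.add h1
      rw [zero_add] at h2
      refine h2.congr fun q => ?_
      simp only [mul_z, inv_x, inv_y, inv_z]
      ring
    fun_prop
  continuous_invFun := by
    rw [continuous_iff_continuousAt]
    intro v
    unfold ContinuousAt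
    rw [tendsto_iff_dist_tendsto_zero]
    have hc : Continuous fun w : ℝ × ℝ × ℝ =>
        dist (⟨w.1, w.2.1, w.2.2⟩ : Heisenberg) ⟨v.1, v.2.1, v.2.2⟩ := by
      simp only [dist_def, gauge, mul_x, mul_y, mul_z, inv_x, inv_y, inv_z]
      refine Continuous.rpow_const (by fun_prop) fun _ => Or.inr (by norm_num)
    simpa using hc.tendsto v

noncomputable instance : MeasurableSpace Heisenberg := borel Heisenberg

instance : BorelSpace Heisenberg := ⟨rfl⟩

/-- Lebesgue measure on `ℝ³`, carried to `Heisenberg` by the coordinates. -/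
noncomputable instance : MeasureSpace Heisenberg where
  volume := (volume : Measure (ℝ × ℝ × ℝ)).map coordinates.symm

/-- The uniform distribution on `W`, i.e. Lebesgue measure restricted to `W` and divided by the
measure of `W`. -/
noncomputable def uniform (W : Set Heisenberg) : Measure Heisenberg :=
  (volume W)⁻¹ • volume.restrict W

theorem volume_apply (W : Set Heisenberg) :
    volume W = (volume : Measure (ℝ × ℝ × ℝ)) (coordinates '' W) := by
  change ((volume : Measure (ℝ × ℝ × ℝ)).map coordinates.symm.toMeasurableEquiv) W = _
  rw [MeasurableEquiv.map_apply]
  congr 1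
  exact (coordinates.image_eq_preimage_symm W).symm

theorem isProbabilityMeasure_uniform {W : Set Heisenberg} (hne : W.Nonempty) (hopen : IsOpen W)
    (hbdd : Bornology.IsBounded W) : IsProbabilityMeasure (uniform W) := by
  have h0 : volume W ≠ 0 := by
    rw [volume_apply]
    exact ((coordinates.isOpenMap W hopen).measure_pos _ (hne.image _)).ne'
  have h1 : volume W ≠ ⊤ := by
    obtain ⟨R, hR⟩ := hbdd.subset_closedBall (1 : Heisenberg)
    have hs : coordinates '' W ⊆
        Set.Icc (-R) R ×ˢ Set.Icc (-R) R ×ˢ Set.Icc (-(R ^ 2)) (R ^ 2) := by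
      rintro _ ⟨p, hp, rfl⟩
      have hd : p.gauge ≤ R := by
        have := Metric.mem_closedBall'.1 (hR hp)
        rwa [dist_def, inv_one, one_mul] at this
      have hh := p.norm_horizontal_le.trans hd
      have hx := (Complex.abs_re_le_norm _).trans hh
      have hy := (Complex.abs_im_le_norm _).trans hh
      have hz : |p.z| ≤ R ^ 2 := by
        have := (Complex.abs_im_le_norm (⟨p.x ^ 2 + p.y ^ 2, p.z⟩ : ℂ)).trans
          p.gauge_sq_eq_norm.ge
        exact this.trans (pow_le_pow_left₀ p.gauge_nonneg hd 2)
      exact ⟨abs_le.1 hx, abs_le.1 hy, abs_le.1 hz⟩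
    rw [volume_apply]
    exact ((isCompact_Icc.prod (isCompact_Icc.prod isCompact_Icc)).measure_lt_top.trans_le'
      (measure_mono hs)).ne
  refine ⟨?_⟩
  simp [uniform, ENNReal.inv_mul_cancel h0 h1]

/-- The infinite product, on `ℕ → Heisenberg`, of the uniform distribution on `W`: the law of an
independent sequence of points that are uniformly distributed on `W`. It is a probability measure
if `W` is non-empty, open and bounded. -/
noncomputable def uniformSequenceLaw (W : Set Heisenberg) : Measure (ℕ → Heisenberg) :=
  Measure.infinitePi fun _ : ℕ => uniform W

theorem isProbabilityMeasure_uniformSequenceLaw {W : Set Heisenberg} (hne : W.Nonempty)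
    (hopen : IsOpen W) (hbdd : Bornology.IsBounded W) :
    IsProbabilityMeasure (uniformSequenceLaw W) :=
  haveI := isProbabilityMeasure_uniform hne hopen hbdd
  inferInstanceAs (IsProbabilityMeasure (Measure.infinitePi fun _ : ℕ => uniform W))

/-- The closed rectangle centred at `p` with radii `r = (r₁, r₂)`: the left translate by `p` of
`{q : x² + y² ≤ r₁², |z| ≤ r₂²}`. -/
def rectangle (p : Heisenberg) (r : ℝ × ℝ) : Set Heisenberg :=
  (fun q => p * q) '' {q | q.x ^ 2 + q.y ^ 2 ≤ r.1 ^ 2 ∧ |q.z| ≤ r.2 ^ 2}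

/-- The points that lie in infinitely many of the rectangles with centres `p n` and radii `r n`. -/
def limsupSet (r : ℕ → ℝ × ℝ) (p : ℕ → Heisenberg) : Set Heisenberg :=
  Filter.limsup (fun n => rectangle (p n) (r n)) Filter.atTop

end Heisenberg

/-- The directed singular value function `Φ^t(r)` of a pair `r` of positive numbers, for
`t ∈ [0, 4]` (for other `t` the value has no meaning and is not used). -/
noncomputable def directedSingularValue (t : ℝ) (r : ℝ × ℝ) : ℝ :=
  if r.1 ≤ r.2 then
    if t ≤ 2 then r.2 ^ t else r.1 ^ (t - 2) * r.2 ^ (2 : ℝ)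
  else
    if t ≤ 3 then r.1 ^ t else r.1 ^ (6 - t) * r.2 ^ (2 * (t - 3))

/-! The upper bound holds for every choice of centres. A rectangle is covered by `n` balls of radius
`ρ` with `n * ρ ^ t` at most a constant times `Φ^t(r)` (`exists_cover_directedSingularValue`):
either one ball, or a grid at scale `r₁` or `r₂² / r₁`. If `∑ Φ^t(r_n)` converges, the tails of
these covers bound the dimension of the limsup set by `t` (`dimH_limsupSet_le`).

For the lower bound let `∑ Φ^t(r_n) = ∞`, `κ < 1` and `s = κ t`. The geometric input is that
normalized Lebesgue measure on a rectangle has `s`-energy at most `D / Φ^t(r)`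
(`exists_rectangleEnergy_le`). It is proved by direct integration at the exponents `0`, `2κ`, `3κ`,
`4κ`; Hölder interpolation between them reproduces the four branches of `Φ^t`. The exponent `3κ`,
relevant for flat rectangles, uses the twist of the group law.

The probabilistic input is a second moment argument. Fix a compact `B ⊂ W`, let `ν` be the uniform
law, and cut the indices into consecutive blocks. In each block average the functions `1_{x ∈ R(p_k,
r_k)} / ν(R(x, r_k))`, which have mean one, with weights proportional to `Φ^t(r_k)`. The product of
the first `j` averages is a density on `B` supported on points that lie in a rectangle from each of
these blocks. The blocks are independent, so the expected mass is constant, and the second moment of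
the mass and the expected energy exceed those of Lebesgue measure on `B` by at most a sum of terms
`M_i² C / ∑_{block i} Φ^t(r_k)`. Divergence lets the blocks be chosen so long that these terms are
summable and small. By Chebyshev and Markov, with probability close to one infinitely many `j` have
mass bounded below and energy bounded above (`exists_blockProduct_frequently`), and compactness
turns this into dimension at least `s` (`le_dimH_iInter_of_energy`). Finally `κ` tends to `1`. -/

section

open Filter Set ProbabilityTheory
open scoped ENNReal NNReal Topology

/-! ### Energy and Hausdorff dimension -/

section Energy

variable {X : Type*} [MetricSpace X] [MeasurableSpace X]

/-- A set of vanishing Hausdorff measure has open covers of arbitrarily small total size. -/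
theorem exists_open_cover_of_hausdorffMeasure_eq_zero [BorelSpace X] {s : ℝ} (hs : 0 < s)
    {A : Set X} (hA : Measure.hausdorffMeasure s A = 0) {η : ℝ≥0∞} (hη : η ≠ 0) :
    ∃ (U : ℕ → Set X) (ρ : ℕ → ℝ≥0∞), (∀ n, IsOpen (U n)) ∧ A ⊆ ⋃ n, U n ∧
      (∀ n, ρ n ≠ 0 ∧ ρ n ≠ ⊤ ∧ Metric.ediam (U n) ≤ ρ n) ∧ ∑' n, ρ n ^ s ≤ η := by
  obtain ⟨ε, hε, hεη⟩ := ENNReal.exists_pos_sum_of_countable' (ENNReal.half_pos hη).ne' ℕ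
  rw [Measure.hausdorffMeasure_apply] at hA
  have h1 := ENNReal.iSup_eq_zero.1 hA 1
  have h2 := ENNReal.iSup_eq_zero.1 h1 one_pos
  have h3 : (⨅ (t : ℕ → Set X) (_ : A ⊆ ⋃ n, t n) (_ : ∀ n, Metric.ediam (t n) ≤ 1),
      ∑' n, ⨆ _ : (t n).Nonempty, Metric.ediam (t n) ^ s) < η / 2 := by
    rw [h2]; exact ENNReal.half_pos hη
  simp only [iInf_lt_iff] at h3
  obtain ⟨t, hcov, hd, hsum⟩ := h3
  set e : ℕ → ℝ≥0∞ := fun n => ⨆ _ : (t n).Nonempty, Metric.ediam (t n) ^ s with he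
  have hde : ∀ n, Metric.ediam (t n) ^ s ≤ e n := by
    intro n
    rcases (t n).eq_empty_or_nonempty with h | h
    · rw [h, Metric.ediam_empty, ENNReal.zero_rpow_of_pos hs]; exact zero_le
    · exact le_iSup (fun _ : (t n).Nonempty => Metric.ediam (t n) ^ s) h
  have hetop : ∀ n, e n ≠ ⊤ := fun n =>
    ((ENNReal.le_tsum n).trans_lt (hsum.trans_le le_top)).ne
  have hεtop : ∀ n, ε n ≠ ⊤ := fun n => ((ENNReal.le_tsum n).trans_lt (hεη.trans_le le_top)).ne
  -- The summable positive `ε` makes `ρ n` strictly larger than the diameter, which leaves room for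
  -- an open thickening.
  set ρ : ℕ → ℝ≥0∞ := fun n => (e n + ε n) ^ s⁻¹ with hρ
  have hρs : ∀ n, ρ n ^ s = e n + ε n := fun n => ENNReal.rpow_inv_rpow hs.ne' _
  have hρtop : ∀ n, ρ n ≠ ⊤ := fun n =>
    ENNReal.rpow_ne_top_of_nonneg (inv_nonneg.2 hs.le) (ENNReal.add_ne_top.2 ⟨hetop n, hεtop n⟩)
  have hlt : ∀ n, Metric.ediam (t n) < ρ n := by
    intro n
    rw [← ENNReal.rpow_lt_rpow_iff hs, hρs]
    exact (hde n).trans_lt (ENNReal.lt_add_right (hetop n) (hε n).ne')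
  have hδ : ∀ n, ∃ δ : ℝ≥0, 0 < δ ∧ Metric.ediam (t n) + 2 * δ ≤ ρ n := by
    intro n
    obtain ⟨δ, hδ0, hδ⟩ := ENNReal.lt_iff_exists_add_pos_lt.1 (hlt n)
    refine ⟨δ / 2, half_pos hδ0, ?_⟩
    rw [ENNReal.coe_div two_ne_zero, ENNReal.coe_ofNat,
      ENNReal.mul_div_cancel two_ne_zero ENNReal.ofNat_ne_top]
    exact hδ.le
  choose δ hδ0 hδ using hδ
  refine ⟨fun n => Metric.thickening (δ n) (t n), ρ, fun n => Metric.isOpen_thickening, ?_, ?_, ?_⟩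
  · exact hcov.trans (iUnion_mono fun n =>
      Metric.self_subset_thickening (NNReal.coe_pos.2 (hδ0 n)) _)
  · exact fun n => ⟨((zero_le).trans_lt (hlt n)).ne', hρtop n,
      (Metric.ediam_thickening_le _).trans (hδ n)⟩
  · simp only [hρs]
    rw [ENNReal.tsum_add]
    calc _ ≤ η / 2 + η / 2 := add_le_add hsum.le hεη.le
      _ = η := ENNReal.add_halves η

/-- On `D × D` the kernel is at least `ρ ^ (-s)`. -/
theorem sq_measure_le_energy (m : Measure X) {s : ℝ} (hs : 0 < s) {D : Set X} {ρ : ℝ≥0∞}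
    (hD : MeasurableSet D) (h0 : ρ ≠ 0) (htop : ρ ≠ ⊤) (hdiam : Metric.ediam D ≤ ρ) :
    m D ^ 2 ≤ ρ ^ s * ∫⁻ x in D, ∫⁻ y in D, edist x y ^ (-s) ∂m ∂m := by
  have hρ : ρ ^ s ≠ ⊤ := ENNReal.rpow_ne_top_of_nonneg hs.le htop
  rw [← lintegral_const_mul' _ _ hρ]
  have key : ∀ x ∈ D, m D ≤ ρ ^ s * ∫⁻ y in D, edist x y ^ (-s) ∂m := by
    intro x hx
    rw [← lintegral_const_mul' _ _ hρ, ← setLIntegral_one]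
    refine setLIntegral_mono' hD fun y hy => ?_
    have h : edist x y ≤ ρ := (Metric.edist_le_ediam_of_mem hx hy).trans hdiam
    calc (1 : ℝ≥0∞) = ρ ^ s * ρ ^ (-s) := by
          rw [← ENNReal.rpow_add _ _ h0 htop, add_neg_cancel, ENNReal.rpow_zero]
      _ ≤ _ := by
          refine mul_le_mul_right ?_ _
          rw [ENNReal.rpow_neg, ENNReal.rpow_neg, ENNReal.inv_le_inv]
          exact ENNReal.rpow_le_rpow h hs.le
  calc m D ^ 2 = ∫⁻ x in D, m D ∂m := by rw [setLIntegral_const, sq]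
    _ ≤ _ := setLIntegral_mono' hD key

/-- Cauchy–Schwarz over the pieces: `m (D i)` is at most the product of the square roots of `ρ i ^
s` and of the energy inside `D i`, and the latter energies add up to at most the total because the
pieces are disjoint. -/
theorem sq_measure_le_sum_mul_energy [BorelSpace X] [SecondCountableTopology X] (m : Measure X)
    {s : ℝ} (hs : 0 < s) {ι : Type*} (u : Finset ι)
    {D : ι → Set X} {ρ : ι → ℝ≥0∞} (hD : ∀ i ∈ u, MeasurableSet (D i))
    (hdisj : (u : Set ι).PairwiseDisjoint D) (h0 : ∀ i ∈ u, ρ i ≠ 0) (htop : ∀ i ∈ u, ρ i ≠ ⊤)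
    (hdiam : ∀ i ∈ u, Metric.ediam (D i) ≤ ρ i) :
    m (⋃ i ∈ u, D i) ^ 2 ≤ (∑ i ∈ u, ρ i ^ s) * ∫⁻ x, ∫⁻ y, edist x y ^ (-s) ∂m ∂m := by
  set E : ι → ℝ≥0∞ := fun i => ∫⁻ x in D i, ∫⁻ y in D i, edist x y ^ (-s) ∂m ∂m
  have hE : ∑ i ∈ u, E i ≤ ∫⁻ x, ∫⁻ y, edist x y ^ (-s) ∂m ∂m := by
    calc ∑ i ∈ u, E i ≤ ∑ i ∈ u, ∫⁻ x in D i, ∫⁻ y, edist x y ^ (-s) ∂m ∂m :=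
          Finset.sum_le_sum fun i _ => lintegral_mono fun x => setLIntegral_le_lintegral _ _
      _ = ∫⁻ x in ⋃ i ∈ u, D i, ∫⁻ y, edist x y ^ (-s) ∂m ∂m :=
          (lintegral_biUnion_finset hdisj hD _).symm
      _ ≤ _ := setLIntegral_le_lintegral _ _
  have hsq : ∀ a : ℝ≥0∞, (a ^ (1 / 2 : ℝ)) ^ 2 = a := fun a => by
    rw [← ENNReal.rpow_natCast, ← ENNReal.rpow_mul]; norm_num
  calc m (⋃ i ∈ u, D i) ^ 2 ≤ (∑ i ∈ u, (ρ i ^ s) ^ (1 / 2 : ℝ) * E i ^ (1 / 2 : ℝ)) ^ 2 := by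
        gcongr
        refine (measure_biUnion_finset_le _ _).trans (Finset.sum_le_sum fun i hi => ?_)
        rw [← ENNReal.mul_rpow_of_nonneg _ _ (by norm_num : (0 : ℝ) ≤ 1 / 2)]
        have := sq_measure_le_energy m hs (hD i hi) (h0 i hi) (htop i hi) (hdiam i hi)
        calc m (D i) = (m (D i) ^ 2) ^ (1 / 2 : ℝ) := by
              rw [← ENNReal.rpow_natCast, ← ENNReal.rpow_mul]; norm_num
          _ ≤ _ := ENNReal.rpow_le_rpow this (by norm_num)
    _ ≤ ((∑ i ∈ u, ((ρ i ^ s) ^ (1 / 2 : ℝ)) ^ (2 : ℝ)) ^ (1 / 2 : ℝ) *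
          (∑ i ∈ u, (E i ^ (1 / 2 : ℝ)) ^ (2 : ℝ)) ^ (1 / 2 : ℝ)) ^ 2 := by
        gcongr
        exact ENNReal.inner_le_Lp_mul_Lq u _ _ Real.HolderConjugate.two_two
    _ = (∑ i ∈ u, ρ i ^ s) * ∑ i ∈ u, E i := by
        rw [mul_pow, hsq, hsq]
        have h2 : ∀ a : ℝ≥0∞, (a ^ (1 / 2 : ℝ)) ^ (2 : ℝ) = a := fun a => by
          rw [← ENNReal.rpow_mul]; norm_num
        simp only [h2]
    _ ≤ _ := by gcongr

/-- A decreasing intersection of compact sets, infinitely many of which carry a measure whose mass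
is bounded from below and whose `s`-energy is bounded from above, has dimension at least `s`. -/
theorem le_dimH_iInter_of_energy [BorelSpace X] [SecondCountableTopology X] {s : ℝ≥0} (hs : 0 < s)
    {A : ℕ → Set X} (hanti : Antitone A)
    (hcomp : ∀ j, IsCompact (A j)) {δ C : ℝ≥0∞} (hδ : δ ≠ 0) (hC : C ≠ ⊤)
    (h : ∃ᶠ j in atTop, ∃ m : Measure X, m (A j)ᶜ = 0 ∧ δ ≤ m univ ∧
      ∫⁻ x, ∫⁻ y, edist x y ^ (-(s : ℝ)) ∂m ∂m ≤ C) :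
    (s : ℝ≥0∞) ≤ dimH (⋂ j, A j) := by
  apply le_dimH_of_hausdorffMeasure_ne_zero
  intro h0
  -- A cover of total size `η` will force `δ ^ 2 ≤ η * C`, so this `η` yields the contradiction.
  obtain ⟨η, hη, hηC⟩ : ∃ η : ℝ≥0∞, η ≠ 0 ∧ η * C < δ ^ 2 := by
    rcases eq_or_ne C 0 with rfl | hC0
    · exact ⟨1, one_ne_zero, by rw [mul_zero]; exact pos_iff_ne_zero.2 (pow_ne_zero _ hδ)⟩
    · rcases eq_or_ne δ ⊤ with rfl | hδt
      · exact ⟨1, one_ne_zero, by simpa using hC.lt_top⟩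
      · refine ⟨δ ^ 2 / 2 / C, ?_, ?_⟩
        · simp [ENNReal.div_eq_zero_iff, hδ, hC]
        · have : δ ^ 2 ≠ 0 := pow_ne_zero _ hδ
          rw [ENNReal.div_mul_cancel hC0 hC]
          exact ENNReal.half_lt_self this (ENNReal.pow_ne_top hδt)
  obtain ⟨U, ρ, hU, hcov, hρ, hsum⟩ :=
    exists_open_cover_of_hausdorffMeasure_eq_zero (NNReal.coe_pos.2 hs) h0 hη
  -- No limit measure is needed: by compactness an open cover of the intersection already covers `A
  -- j` for all large `j`, and one of these carries a measure `m`.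
  obtain ⟨N, hN⟩ := exists_subset_nhds_of_isCompact hanti.directed_ge hcomp
    (U := ⋃ n, U n) (fun x hx => (isOpen_iUnion hU).mem_nhds (hcov hx))
  obtain ⟨j, hj, m, hmA, hmδ, hmC⟩ := frequently_atTop.1 h N
  have hAj : A j ⊆ ⋃ n, U n := (hanti hj).trans hN
  obtain ⟨u, hu⟩ := (hcomp j).elim_finite_subcover U hU hAj
  obtain ⟨M, hM⟩ : ∃ M, u ⊆ Finset.range M := ⟨_, Finset.subset_range_sup_succ u⟩
  have hsub : A j ⊆ ⋃ i ∈ Finset.range M, disjointed U i := by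
    intro x hx
    obtain ⟨i, hi, hxi⟩ := mem_iUnion₂.1 (hu hx)
    have hxp : x ∈ partialSups U i := by
      rw [partialSups_eq_biSup]
      exact mem_iUnion₂.2 ⟨i, le_rfl, hxi⟩
    rw [← partialSups_disjointed, partialSups_eq_biSup] at hxp
    obtain ⟨k, hk, hxk⟩ := mem_iUnion₂.1 hxp
    exact mem_iUnion₂.2 ⟨k, Finset.mem_range.2 (hk.trans_lt (Finset.mem_range.1 (hM hi))), hxk⟩
  have hle := sq_measure_le_sum_mul_energy m (NNReal.coe_pos.2 hs) (Finset.range M)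
    (D := disjointed U) (ρ := ρ)
    (fun i _ => MeasurableSet.disjointed (fun n => (hU n).measurableSet) i)
    ((disjoint_disjointed U).set_pairwise _) (fun i _ => (hρ i).1) (fun i _ => (hρ i).2.1)
    (fun i _ => (Metric.ediam_mono (disjointed_subset U i)).trans (hρ i).2.2)
  have huniv : m univ ≤ m (⋃ i ∈ Finset.range M, disjointed U i) := by
    calc m univ ≤ m (A j) + m (A j)ᶜ := by
          rw [← union_compl_self (A j)]; exact measure_union_le _ _
      _ ≤ _ := by rw [hmA, add_zero]; exact measure_mono hsub
  have : δ ^ 2 ≤ η * C := by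
    calc δ ^ 2 ≤ m (⋃ i ∈ Finset.range M, disjointed U i) ^ 2 := by
          gcongr; exact hmδ.trans huniv
      _ ≤ _ := hle
      _ ≤ η * C := by
          gcongr
          exact (ENNReal.sum_le_tsum _).trans hsum
  exact this.not_gt hηC

end Energy

/-! ### Two probabilistic estimates -/

section SecondMoment

variable {Ω : Type*} [MeasurableSpace Ω]

/-- Chebyshev's inequality for the lower tail of a function with values in `[0, ∞]`. -/
theorem sq_mul_measure_lt_half_le (P : Measure Ω) [IsProbabilityMeasure P] {Z : Ω → ℝ≥0∞}
    (hZ : Measurable Z) {a η : ℝ≥0∞} (ha : a ≠ ⊤) (h1 : ∫⁻ ω, Z ω ∂P = a)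
    (h2 : ∫⁻ ω, Z ω ^ 2 ∂P ≤ a ^ 2 + η) :
    (a / 2) ^ 2 * P {ω | Z ω < a / 2} ≤ η := by
  -- This is `(a / 2) ^ 2 ≤ (Z - a) ^ 2` on the event `Z < a / 2`, and `0 ≤ (Z - a) ^ 2` off it,
  -- rearranged to avoid subtraction in `ℝ≥0∞`.
  have hpt : ∀ ω, 2 * a * Z ω + {ω | Z ω < a / 2}.indicator (fun _ => (a / 2) ^ 2) ω ≤
      Z ω ^ 2 + a ^ 2 := by
    intro ω
    rcases eq_or_ne (Z ω) ⊤ with h | h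
    · simp [h]
    lift a to ℝ≥0 using ha
    generalize hz : Z ω = z at h
    lift z to ℝ≥0 using h
    have h4 : ((a : ℝ≥0∞) / 2) = ((a / 2 : ℝ≥0) : ℝ≥0∞) := by
      rw [ENNReal.coe_div two_ne_zero, ENNReal.coe_ofNat]
    by_cases hlt : Z ω < (a : ℝ≥0∞) / 2
    · rw [indicator_of_mem (by exact hlt), h4]
      rw [hz, h4, ENNReal.coe_lt_coe] at hlt
      norm_cast
      rw [← NNReal.coe_le_coe]
      rw [← NNReal.coe_lt_coe] at hlt
      push_cast at hlt ⊢
      nlinarith [NNReal.coe_nonneg a, NNReal.coe_nonneg z]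
    · rw [indicator_of_notMem (by exact hlt), add_zero]
      norm_cast
      rw [← NNReal.coe_le_coe]
      push_cast
      nlinarith [sq_nonneg ((a : ℝ) - z)]
  have hms : MeasurableSet {ω | Z ω < a / 2} := measurableSet_lt hZ measurable_const
  have hint := lintegral_mono (μ := P) hpt
  rw [lintegral_add_right _ (measurable_const.indicator hms), lintegral_const_mul _ hZ, h1,
    lintegral_indicator_const hms, lintegral_add_right _ measurable_const, lintegral_const,
    measure_univ, mul_one] at hint
  have h3 : a ^ 2 + a ^ 2 + (a / 2) ^ 2 * P {ω | Z ω < a / 2} ≤ a ^ 2 + a ^ 2 + η := by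
    calc _ = 2 * a * a + (a / 2) ^ 2 * P {ω | Z ω < a / 2} := by ring
      _ ≤ _ := hint
      _ ≤ a ^ 2 + η + a ^ 2 := by gcongr
      _ = _ := by ring
  have hfin : a ^ 2 + a ^ 2 ≠ ⊤ :=
    ENNReal.add_ne_top.2 ⟨ENNReal.pow_ne_top ha, ENNReal.pow_ne_top ha⟩
  exact (ENNReal.add_le_add_iff_left hfin).1 h3

/-- Continuity from below. With `S j` the bad event at stage `j`, the good event occurs infinitely
often except with probability at most `ε`; no independence between stages is required. -/
theorem measure_eventually_notMem_le (P : Measure Ω) {S : ℕ → Set Ω} {ε : ℝ≥0∞}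
    (h : ∀ j, P (S j) ≤ ε) : P {ω | ∀ᶠ j in atTop, ω ∈ S j} ≤ ε := by
  have : {ω | ∀ᶠ j in atTop, ω ∈ S j} = ⋃ n, ⋂ j ≥ n, S j := by
    ext ω; simp [eventually_atTop]
  rw [this, Monotone.measure_iUnion]
  · exact iSup_le fun n => (measure_mono (iInter₂_subset n le_rfl)).trans (h n)
  · intro m n hmn ω hω
    simp only [mem_iInter] at hω ⊢
    exact fun j hj => hω j (hmn.trans hj)

end SecondMoment

/-! ### Independence of disjoint groups of coordinates -/

section Coordinates

variable {Y : Type*} [MeasurableSpace Y]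

/-- The `σ`-algebra on sequences generated by the coordinates with index in `S`. -/
@[reducible] def coordinateSigma (Y : Type*) [MeasurableSpace Y] (S : Set ℕ) :
    MeasurableSpace (ℕ → Y) :=
  ⨆ i ∈ S, MeasurableSpace.comap (fun ω : ℕ → Y => ω i) inferInstance

theorem coordinateSigma_le (S : Set ℕ) : coordinateSigma Y S ≤ MeasurableSpace.pi :=
  iSup₂_le fun i _ => (measurable_pi_apply i).comap_le

theorem measurable_coordinateSigma {Z : Type*} [MeasurableSpace Z] {S : Set ℕ} {n : ℕ}
    (hn : n ∈ S) {h : Y → Z} (hh : Measurable h) :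
    Measurable[coordinateSigma Y S] fun ω : ℕ → Y => h (ω n) := by
  refine hh.comp ?_
  rw [measurable_iff_comap_le]
  exact le_iSup₂ (f := fun i (_ : i ∈ S) =>
    MeasurableSpace.comap (fun ω : ℕ → Y => ω i) inferInstance) n hn

variable (ν : Measure Y) [IsProbabilityMeasure ν]

theorem lintegral_mul_of_disjoint_coordinates {S T : Set ℕ} (hST : Disjoint S T)
    {f h : (ℕ → Y) → ℝ≥0∞} (hf : Measurable[coordinateSigma Y S] f)
    (hh : Measurable[coordinateSigma Y T] h) :
    ∫⁻ ω, f ω * h ω ∂Measure.infinitePi (fun _ : ℕ => ν) =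
      (∫⁻ ω, f ω ∂Measure.infinitePi (fun _ : ℕ => ν)) *
        ∫⁻ ω, h ω ∂Measure.infinitePi (fun _ : ℕ => ν) := by
  have hind : iIndepFun (fun (i : ℕ) (ω : ℕ → Y) => ω i) (Measure.infinitePi fun _ : ℕ => ν) :=
    iIndepFun_infinitePi (X := fun _ => id) fun _ => measurable_id
  exact lintegral_mul_eq_lintegral_mul_lintegral_of_independent_measurableSpace
    (coordinateSigma_le S) (coordinateSigma_le T)
    (indep_iSup_of_disjoint (fun i => (measurable_pi_apply i).comap_le) hind hST) hf hh

theorem lintegral_coordinate (n : ℕ) {h : Y → ℝ≥0∞} (hh : Measurable h) :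
    ∫⁻ ω, h (ω n) ∂Measure.infinitePi (fun _ : ℕ => ν) = ∫⁻ y, h y ∂ν :=
  (measurePreserving_eval_infinitePi (fun _ : ℕ => ν) n).lintegral_comp hh

end Coordinates

/-! ### First and second moments of one block -/

section Blocks

variable {X Y : Type*}

/-- The weighted average of the functions `g k (ω k)`, `k ∈ u`, with weights proportional
to `φ k`. -/
noncomputable def blockDensity (φ : ℕ → ℝ≥0∞) (g : ℕ → Y → X → ℝ≥0∞) (u : Finset ℕ) (ω : ℕ → Y)
    (x : X) : ℝ≥0∞ :=
  ∑ k ∈ u, φ k / (∑ i ∈ u, φ i) * g k (ω k) x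

variable {φ : ℕ → ℝ≥0∞} {g : ℕ → Y → X → ℝ≥0∞}

theorem sum_weights (hφ0 : ∀ n, φ n ≠ 0) (hφ : ∀ n, φ n ≠ ⊤) {u : Finset ℕ} (hu : u.Nonempty) :
    ∑ k ∈ u, φ k / (∑ i ∈ u, φ i) = 1 := by
  simp only [div_eq_mul_inv]
  rw [← Finset.sum_mul]
  refine ENNReal.mul_inv_cancel ?_ (ENNReal.sum_ne_top.2 fun i _ => hφ i)
  obtain ⟨k, hk⟩ := hu
  exact fun h => hφ0 k (Finset.sum_eq_zero_iff.1 h k hk)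

theorem exists_blockDensity_ne_zero {u : Finset ℕ} {ω : ℕ → Y} {x : X}
    (h : blockDensity φ g u ω x ≠ 0) : ∃ k ∈ u, g k (ω k) x ≠ 0 := by
  obtain ⟨k, hk, hne⟩ := Finset.exists_ne_zero_of_sum_ne_zero h
  exact ⟨k, hk, right_ne_zero_of_mul hne⟩

theorem exists_blockDensity_le (hbdd : ∀ n, ∃ b : ℝ≥0, ∀ y x, g n y x ≤ b) (u : Finset ℕ) :
    ∃ b : ℝ≥0, ∀ ω x, blockDensity φ g u ω x ≤ b := by
  choose b hb using hbdd
  refine ⟨∑ k ∈ u, b k, fun ω x => ?_⟩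
  rw [ENNReal.ofNNReal_finsetSum]
  refine Finset.sum_le_sum fun k hk => ?_
  calc _ ≤ 1 * (b k : ℝ≥0∞) := by
        gcongr
        · exact ENNReal.div_le_of_le_mul (by
            rw [one_mul]; exact Finset.single_le_sum (fun _ _ => zero_le) hk)
        · exact hb k _ _
    _ = b k := one_mul _

variable [MeasurableSpace X] [MeasurableSpace Y]

theorem measurable_blockDensity (hg : ∀ n, Measurable (Function.uncurry (g n))) (u : Finset ℕ) :
    Measurable (Function.uncurry (blockDensity φ g u)) := by
  refine Finset.measurable_fun_sum u fun k _ => Measurable.const_mul ?_ _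
  exact (hg k).comp (g := Function.uncurry (g k)) (f := fun p : (ℕ → Y) × X => (p.1 k, p.2))
    (((measurable_pi_apply k).comp measurable_fst).prodMk measurable_snd)

theorem measurable_blockDensity_coordinates (hg : ∀ n, Measurable (Function.uncurry (g n)))
    {u : Finset ℕ} {S : Set ℕ} (hu : ↑u ⊆ S) (x : X) :
    Measurable[coordinateSigma Y S] fun ω => blockDensity φ g u ω x := by
  refine @Finset.measurable_fun_sum _ _ _ _ _ _ (coordinateSigma Y S) _ u fun k hk =>
    Measurable.const_mul ?_ _
  exact measurable_coordinateSigma (hu hk) ((hg k).comp measurable_prodMk_right)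

variable (ν : Measure Y) [IsProbabilityMeasure ν]

theorem lintegral_blockDensity (hφ0 : ∀ n, φ n ≠ 0) (hφ : ∀ n, φ n ≠ ⊤)
    (hg : ∀ n, Measurable (Function.uncurry (g n))) (hmean : ∀ n x, ∫⁻ y, g n y x ∂ν = 1)
    {u : Finset ℕ} (hu : u.Nonempty) (x : X) :
    ∫⁻ ω, blockDensity φ g u ω x ∂Measure.infinitePi (fun _ : ℕ => ν) = 1 := by
  have hk : ∀ k, Measurable fun y => g k y x := fun k => (hg k).comp measurable_prodMk_right
  have hk' : ∀ k, Measurable fun ω : ℕ → Y => g k (ω k) x := fun k =>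
    (hk k).comp (measurable_pi_apply k)
  unfold blockDensity
  rw [lintegral_finsetSum _ fun k _ => (hk' k).const_mul _, ← sum_weights hφ0 hφ hu]
  refine Finset.sum_congr rfl fun k _ => ?_
  rw [lintegral_const_mul _ (hk' k), lintegral_coordinate ν k (hk k), hmean, mul_one]

/-- Expand into a double sum over indices `k`, `l`. For `k ≠ l` the factors are independent with
mean one, so these terms contribute at most the square of the total weight, which is `1`; the
diagonal gives the second summand. -/
theorem lintegral_blockDensity_mul_le (hφ0 : ∀ n, φ n ≠ 0) (hφ : ∀ n, φ n ≠ ⊤)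
    (hg : ∀ n, Measurable (Function.uncurry (g n))) (hmean : ∀ n x, ∫⁻ y, g n y x ∂ν = 1)
    {u : Finset ℕ} (hu : u.Nonempty) (x x' : X) :
    ∫⁻ ω, blockDensity φ g u ω x * blockDensity φ g u ω x' ∂Measure.infinitePi (fun _ : ℕ => ν) ≤
      1 + ∑ k ∈ u, (φ k / (∑ i ∈ u, φ i)) ^ 2 * ∫⁻ y, g k y x * g k y x' ∂ν := by
  have hk : ∀ k x, Measurable fun y => g k y x := fun k x => (hg k).comp measurable_prodMk_right
  have hk' : ∀ k x, Measurable fun ω : ℕ → Y => g k (ω k) x := fun k x =>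
    (hk k x).comp (measurable_pi_apply k)
  have hmul : ∀ k l, Measurable fun ω : ℕ → Y => g k (ω k) x * g l (ω l) x' := fun k l =>
    (hk' k x).mul (hk' l x')
  set w : ℕ → ℝ≥0∞ := fun k => φ k / (∑ i ∈ u, φ i) with hw
  have hexp : ∀ ω : ℕ → Y, blockDensity φ g u ω x * blockDensity φ g u ω x' =
      ∑ k ∈ u, ∑ l ∈ u, w k * w l * (g k (ω k) x * g l (ω l) x') := by
    intro ω
    unfold blockDensity
    rw [Finset.sum_mul_sum]
    refine Finset.sum_congr rfl fun k _ => Finset.sum_congr rfl fun l _ => ?_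
    simp only [hw]; ring
  simp only [hexp]
  rw [lintegral_finsetSum _ fun k _ => Finset.measurable_fun_sum _ fun l _ =>
    (hmul k l).const_mul _]
  have hterm : ∀ k ∈ u, ∫⁻ ω : ℕ → Y, ∑ l ∈ u, w k * w l * (g k (ω k) x * g l (ω l) x')
      ∂Measure.infinitePi (fun _ : ℕ => ν) ≤
      ∑ l ∈ u, w k * w l + w k ^ 2 * ∫⁻ y, g k y x * g k y x' ∂ν := by
    intro k hku
    rw [lintegral_finsetSum _ fun l _ => (hmul k l).const_mul _,
      ← Finset.add_sum_erase u _ hku, add_comm]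
    gcongr ?_ + ?_
    · refine (Finset.sum_le_sum fun l hl => ?_).trans
        (Finset.sum_le_sum_of_subset (Finset.erase_subset k u))
      rw [lintegral_const_mul _ (hmul k l),
        lintegral_mul_of_disjoint_coordinates ν (S := {k}) (T := {l})
          (by simpa using (Finset.ne_of_mem_erase hl).symm)
          (measurable_coordinateSigma (mem_singleton k) (hk k x))
          (measurable_coordinateSigma (mem_singleton l) (hk l x')),
        lintegral_coordinate ν k (hk k x), lintegral_coordinate ν l (hk l x'), hmean, hmean]
      simp
    · rw [lintegral_const_mul _ (hmul k k),
        lintegral_coordinate ν k (h := fun y => g k y x * g k y x') ((hk k x).mul (hk k x')), sq]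
  refine (Finset.sum_le_sum hterm).trans ?_
  rw [Finset.sum_add_distrib, ← Finset.sum_mul_sum, sum_weights hφ0 hφ hu, one_mul]

/-- The excess in the second moment of `blockDensity` over that of independent factors. -/
noncomputable def blockExcess (φ : ℕ → ℝ≥0∞) (g : ℕ → Y → X → ℝ≥0∞) (u : Finset ℕ) (x x' : X) :
    ℝ≥0∞ :=
  ∑ k ∈ u, (φ k / (∑ i ∈ u, φ i)) ^ 2 * ∫⁻ y, g k y x * g k y x' ∂ν

theorem measurable_blockExcess (hg : ∀ n, Measurable (Function.uncurry (g n))) (u : Finset ℕ) :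
    Measurable fun p : X × X => blockExcess ν φ g u p.1 p.2 := by
  refine Finset.measurable_fun_sum u fun k _ => Measurable.const_mul ?_ _
  refine Measurable.lintegral_prod_right' (f := fun q : (X × X) × Y =>
    g k q.2 q.1.1 * g k q.2 q.1.2) ?_
  exact ((hg k).comp (measurable_snd.prodMk (measurable_fst.comp measurable_fst))).mul
    ((hg k).comp (measurable_snd.prodMk (measurable_snd.comp measurable_fst)))

/-- Tonelli, used both for a single `g k` and for the whole product of blocks. -/
theorem lintegral_mul_expectation {Ω : Type*} [MeasurableSpace Ω] (P : Measure Ω) [SFinite P]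
    (m : Measure X) [SFinite m]
    {K : X → X → ℝ≥0∞} (hK : Measurable (Function.uncurry K)) {F : Ω → X → ℝ≥0∞}
    (hF : Measurable (Function.uncurry F)) :
    ∫⁻ x, ∫⁻ x', K x x' * ∫⁻ ω, F ω x * F ω x' ∂P ∂m ∂m =
      ∫⁻ ω, ∫⁻ x, ∫⁻ x', K x x' * (F ω x * F ω x') ∂m ∂m ∂P := by
  have hF' : ∀ x, Measurable fun ω => F ω x := fun x => hF.comp measurable_prodMk_right
  have h3 : Measurable fun q : (Ω × X) × X => K q.1.2 q.2 * (F q.1.1 q.1.2 * F q.1.1 q.2) :=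
    (hK.comp ((measurable_snd.comp measurable_fst).prodMk measurable_snd)).mul
      ((hF.comp measurable_fst).mul
        (hF.comp ((measurable_fst.comp measurable_fst).prodMk measurable_snd)))
  have h4 : ∀ x, ∫⁻ x', K x x' * ∫⁻ ω, F ω x * F ω x' ∂P ∂m =
      ∫⁻ ω, ∫⁻ x', K x x' * (F ω x * F ω x') ∂m ∂P := by
    intro x
    have hx : Measurable fun q : Ω × X => K x q.2 * (F q.1 x * F q.1 q.2) :=
      h3.comp (f := fun q : Ω × X => ((q.1, x), q.2))
        ((measurable_fst.prodMk measurable_const).prodMk measurable_snd)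
    rw [lintegral_lintegral_swap hx.aemeasurable]
    exact lintegral_congr fun x' => (lintegral_const_mul _ ((hF' x).mul (hF' x'))).symm
  simp only [h4]
  exact (lintegral_lintegral_swap (Measurable.lintegral_prod_right' h3).aemeasurable).symm

/-- This is why the weights are proportional to `φ`. With `T` the sum of `φ` over the block, index
`k` contributes `(φ k / T) ^ 2 * (C / φ k) = (φ k / T) * (C / T)`, and the weights add up to one. -/
theorem lintegral_blockExcess_le (m : Measure X) [SFinite m] (hφ0 : ∀ n, φ n ≠ 0)
    (hφ : ∀ n, φ n ≠ ⊤)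
    (hg : ∀ n, Measurable (Function.uncurry (g n)))
    {K : X → X → ℝ≥0∞} (hK : Measurable (Function.uncurry K)) {C : ℝ≥0∞}
    (hC : ∀ n, ∫⁻ y, ∫⁻ x, ∫⁻ x', K x x' * (g n y x * g n y x') ∂m ∂m ∂ν ≤ C / φ n)
    {u : Finset ℕ} (hu : u.Nonempty) :
    ∫⁻ x, ∫⁻ x', K x x' * blockExcess ν φ g u x x' ∂m ∂m ≤ C / ∑ i ∈ u, φ i := by
  have hT : ∑ i ∈ u, φ i ≠ ⊤ := ENNReal.sum_ne_top.2 fun i _ => hφ i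
  have hT0 : ∑ i ∈ u, φ i ≠ 0 := by
    obtain ⟨k, hk⟩ := hu
    exact fun h => hφ0 k (Finset.sum_eq_zero_iff.1 h k hk)
  have hm : ∀ k, Measurable fun p : X × X => K p.1 p.2 * ∫⁻ y, g k y p.1 * g k y p.2 ∂ν := by
    intro k
    refine hK.mul (Measurable.lintegral_prod_right' (f := fun q : (X × X) × Y =>
      g k q.2 q.1.1 * g k q.2 q.1.2) ?_)
    exact ((hg k).comp (measurable_snd.prodMk (measurable_fst.comp measurable_fst))).mul
      ((hg k).comp (measurable_snd.prodMk (measurable_snd.comp measurable_fst)))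
  calc _ = ∫⁻ x, ∫⁻ x', ∑ k ∈ u, (φ k / (∑ i ∈ u, φ i)) ^ 2 *
        (K x x' * ∫⁻ y, g k y x * g k y x' ∂ν) ∂m ∂m := by
        refine lintegral_congr fun x => lintegral_congr fun x' => ?_
        unfold blockExcess
        rw [Finset.mul_sum]
        exact Finset.sum_congr rfl fun k _ => by ring
    _ = ∑ k ∈ u, (φ k / (∑ i ∈ u, φ i)) ^ 2 *
        ∫⁻ x, ∫⁻ x', K x x' * ∫⁻ y, g k y x * g k y x' ∂ν ∂m ∂m := by
        have h1 : ∀ x, ∫⁻ x', ∑ k ∈ u, (φ k / (∑ i ∈ u, φ i)) ^ 2 *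
            (K x x' * ∫⁻ y, g k y x * g k y x' ∂ν) ∂m = ∑ k ∈ u, (φ k / (∑ i ∈ u, φ i)) ^ 2 *
            ∫⁻ x', K x x' * ∫⁻ y, g k y x * g k y x' ∂ν ∂m := by
          intro x
          have hx : ∀ k, Measurable fun x' => K x x' * ∫⁻ y, g k y x * g k y x' ∂ν :=
            fun k => (hm k).comp measurable_prodMk_left
          rw [lintegral_finsetSum _ fun k _ => (hx k).const_mul _]
          exact Finset.sum_congr rfl fun k _ => lintegral_const_mul _ (hx k)
        simp only [h1]
        have hx : ∀ k, Measurable fun x => ∫⁻ x', K x x' * ∫⁻ y, g k y x * g k y x' ∂ν ∂m :=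
          fun k => (hm k).lintegral_prod_right'
        rw [lintegral_finsetSum _ fun k _ => (hx k).const_mul _]
        exact Finset.sum_congr rfl fun k _ => lintegral_const_mul _ (hx k)
    _ ≤ ∑ k ∈ u, φ k / (∑ i ∈ u, φ i) * (C / ∑ i ∈ u, φ i) := by
        refine Finset.sum_le_sum fun k _ => ?_
        rw [lintegral_mul_expectation ν m hK (hg k)]
        calc _ ≤ (φ k / (∑ i ∈ u, φ i)) ^ 2 * (C / φ k) := by gcongr; exact hC k
          _ = φ k / (∑ i ∈ u, φ i) * (C / ∑ i ∈ u, φ i) * (φ k * (φ k)⁻¹) := by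
              simp only [div_eq_mul_inv]; ring
          _ = _ := by rw [ENNReal.mul_inv_cancel (hφ0 k) (hφ k), mul_one]
    _ = C / ∑ i ∈ u, φ i := by rw [← Finset.sum_mul, sum_weights hφ0 hφ hu, one_mul]

end Blocks

/-! ### Products over successive blocks -/

section BlockProducts

theorem exists_lt_sum_Ico {φ : ℕ → ℝ≥0∞} (hφ : ∀ n, φ n ≠ ⊤) (hsum : ∑' n, φ n = ⊤) (N : ℕ)
    {B : ℝ≥0∞} (hB : B ≠ ⊤) : ∃ N', N < N' ∧ B < ∑ i ∈ Finset.Ico N N', φ i := by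
  have ht : Tendsto (fun n => ∑ i ∈ Finset.range n, φ i) atTop (𝓝 ⊤) := by
    rw [← hsum]; exact ENNReal.tendsto_nat_tsum φ
  have hfin : ∑ i ∈ Finset.range N, φ i ≠ ⊤ := ENNReal.sum_ne_top.2 fun i _ => hφ i
  obtain ⟨N', h1, h2⟩ := (((tendsto_order.1 ht).1 _
    (ENNReal.add_ne_top.2 ⟨hfin, hB⟩).lt_top).and (eventually_gt_atTop N)).exists
  refine ⟨N', h2, ?_⟩
  rw [← Finset.sum_range_add_sum_Ico _ h2.le] at h1
  exact (ENNReal.add_lt_add_iff_left hfin).1 h1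

/-- `M j` is to bound the product of the first `j` block densities, so it is known before block `j`
is chosen. Divergence of the series then allows a block long enough to beat `M j ^ 2`. -/
theorem exists_blocks {φ : ℕ → ℝ≥0∞} (hφ : ∀ n, φ n ≠ ⊤) (hsum : ∑' n, φ n = ⊤)
    {C : ℝ≥0∞} (hC : C ≠ ⊤) (b : ℕ → ℕ → ℝ≥0) {ε : ℕ → ℝ≥0∞} (hε : ∀ j, ε j ≠ 0) :
    ∃ (N : ℕ → ℕ) (M : ℕ → ℝ≥0), StrictMono N ∧ M 0 = 1 ∧
      (∀ j, M (j + 1) = M j * b (N j) (N (j + 1))) ∧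
      ∀ j, (M j : ℝ≥0∞) ^ 2 * (C / ∑ i ∈ Finset.Ico (N j) (N (j + 1)), φ i) ≤ ε j := by
  have hnext : ∀ (j N : ℕ) (M : ℝ≥0), ∃ N', N < N' ∧
      (M : ℝ≥0∞) ^ 2 * (C / ∑ i ∈ Finset.Ico N N', φ i) ≤ ε j := by
    intro j N M
    have hMC : (M : ℝ≥0∞) ^ 2 * C ≠ ⊤ :=
      ENNReal.mul_ne_top (ENNReal.pow_ne_top ENNReal.coe_ne_top) hC
    obtain ⟨N', h1, h2⟩ := exists_lt_sum_Ico hφ hsum N (ENNReal.div_ne_top hMC (hε j))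
    refine ⟨N', h1, ?_⟩
    rw [← mul_div_assoc]
    refine ENNReal.div_le_of_le_mul ?_
    rw [mul_comm (ε j)]
    exact (ENNReal.div_le_iff_le_mul (Or.inl (hε j))
      (Or.inr ((zero_le).trans_lt h2).ne')).1 h2.le
  choose next hnext1 hnext2 using hnext
  let st : ℕ → ℕ × ℝ≥0 := fun j => Nat.rec (0, 1)
    (fun j p => (next j p.1 p.2, p.2 * b p.1 (next j p.1 p.2))) j
  exact ⟨fun j => (st j).1, fun j => (st j).2, strictMono_nat_of_lt_succ fun j => hnext1 _ _ _, rfl,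
    fun j => rfl, fun j => hnext2 _ _ _⟩

variable {X Y : Type*}

/-- The product of the first `j` of the block densities for the blocks `[N i, N (i + 1))`. -/
noncomputable def blockProduct (φ : ℕ → ℝ≥0∞) (g : ℕ → Y → X → ℝ≥0∞) (N : ℕ → ℕ) (j : ℕ)
    (ω : ℕ → Y) (x : X) : ℝ≥0∞ :=
  ∏ i ∈ Finset.range j, blockDensity φ g (Finset.Ico (N i) (N (i + 1))) ω x

variable {φ : ℕ → ℝ≥0∞} {g : ℕ → Y → X → ℝ≥0∞} {N : ℕ → ℕ}

theorem exists_mem_block_of_blockProduct_ne_zero {j : ℕ} {ω : ℕ → Y} {x : X}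
    (h : blockProduct φ g N j ω x ≠ 0) {i : ℕ} (hi : i < j) :
    ∃ k ∈ Finset.Ico (N i) (N (i + 1)), g k (ω k) x ≠ 0 :=
  exists_blockDensity_ne_zero (Finset.prod_ne_zero_iff.1 h i (Finset.mem_range.2 hi))

variable [MeasurableSpace X] [MeasurableSpace Y]

theorem measurable_blockProduct (hg : ∀ n, Measurable (Function.uncurry (g n))) (j : ℕ) :
    Measurable (Function.uncurry (blockProduct φ g N j)) := by
  change Measurable fun p : (ℕ → Y) × X =>
    ∏ i ∈ Finset.range j, blockDensity φ g (Finset.Ico (N i) (N (i + 1))) p.1 p.2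
  exact Finset.measurable_fun_prod _ fun i _ => measurable_blockDensity hg _

theorem measurable_blockProduct_coordinates (hg : ∀ n, Measurable (Function.uncurry (g n)))
    (hN : Monotone N) (j : ℕ) (x : X) :
    Measurable[coordinateSigma Y (Iio (N j))] fun ω => blockProduct φ g N j ω x := by
  refine @Finset.measurable_fun_prod _ _ _ _ _ _ (coordinateSigma Y (Iio (N j))) _ _ fun i hi => ?_
  refine measurable_blockDensity_coordinates hg (fun k hk => ?_) x
  exact (Finset.mem_Ico.1 hk).2.trans_le (hN (Nat.succ_le_of_lt (Finset.mem_range.1 hi)))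

variable (ν : Measure Y) [IsProbabilityMeasure ν]

theorem lintegral_blockProduct (hφ0 : ∀ n, φ n ≠ 0) (hφ : ∀ n, φ n ≠ ⊤)
    (hg : ∀ n, Measurable (Function.uncurry (g n))) (hmean : ∀ n x, ∫⁻ y, g n y x ∂ν = 1)
    (hN : StrictMono N) (j : ℕ) (x : X) :
    ∫⁻ ω, blockProduct φ g N j ω x ∂Measure.infinitePi (fun _ : ℕ => ν) = 1 := by
  induction j with
  | zero => simp [blockProduct]
  | succ j ih =>
    have h : ∀ ω, blockProduct φ g N (j + 1) ω x = blockProduct φ g N j ω x *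
        blockDensity φ g (Finset.Ico (N j) (N (j + 1))) ω x := fun ω => Finset.prod_range_succ _ _
    simp only [h]
    rw [lintegral_mul_of_disjoint_coordinates ν (S := Iio (N j)) (T := Ici (N j))
      (Iio_disjoint_Ici le_rfl) (measurable_blockProduct_coordinates hg hN.monotone j x)
      (measurable_blockDensity_coordinates hg (fun k hk => (Finset.mem_Ico.1 hk).1) x), ih,
      lintegral_blockDensity ν hφ0 hφ hg hmean (by simpa using hN (Nat.lt_succ_self j)), one_mul]

/-- By independence a new block multiplies the expectation by at most `1 + blockExcess`. The extra
term is kept additive by bounding the earlier expectation crudely by `M j ^ 2`. -/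
theorem lintegral_blockProduct_mul_le (hφ0 : ∀ n, φ n ≠ 0) (hφ : ∀ n, φ n ≠ ⊤)
    (hg : ∀ n, Measurable (Function.uncurry (g n))) (hmean : ∀ n x, ∫⁻ y, g n y x ∂ν = 1)
    (hN : StrictMono N) {M : ℕ → ℝ≥0} (hM : ∀ j ω x, blockProduct φ g N j ω x ≤ M j)
    (j : ℕ) (x x' : X) :
    ∫⁻ ω, blockProduct φ g N j ω x * blockProduct φ g N j ω x'
      ∂Measure.infinitePi (fun _ : ℕ => ν) ≤
      1 + ∑ i ∈ Finset.range j,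
        (M i : ℝ≥0∞) ^ 2 * blockExcess ν φ g (Finset.Ico (N i) (N (i + 1))) x x' := by
  induction j with
  | zero => simp [blockProduct]
  | succ j ih =>
    set u := Finset.Ico (N j) (N (j + 1))
    have h : ∀ ω, blockProduct φ g N (j + 1) ω x * blockProduct φ g N (j + 1) ω x' =
        (blockProduct φ g N j ω x * blockProduct φ g N j ω x') *
        (blockDensity φ g u ω x * blockDensity φ g u ω x') := fun ω => by
      rw [blockProduct, blockProduct, Finset.prod_range_succ, Finset.prod_range_succ]
      exact mul_mul_mul_comm _ _ _ _
    have hP := fun x => measurable_blockProduct_coordinates (φ := φ) hg hN.monotone j x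
    have hu : ∀ k ∈ (u : Set ℕ), k ∈ Ici (N j) := fun k hk => (Finset.mem_Ico.1 hk).1
    have hD := fun x => measurable_blockDensity_coordinates (φ := φ) hg hu x
    have hPP : Measurable[coordinateSigma Y (Iio (N j))] fun ω =>
      blockProduct φ g N j ω x * blockProduct φ g N j ω x' := (hP x).mul (hP x')
    have hDD : Measurable[coordinateSigma Y (Ici (N j))] fun ω =>
      blockDensity φ g u ω x * blockDensity φ g u ω x' := (hD x).mul (hD x')
    simp only [h]
    rw [lintegral_mul_of_disjoint_coordinates ν (S := Iio (N j)) (T := Ici (N j))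
      (f := fun ω => blockProduct φ g N j ω x * blockProduct φ g N j ω x')
      (h := fun ω => blockDensity φ g u ω x * blockDensity φ g u ω x')
      (Iio_disjoint_Ici le_rfl) hPP hDD,
      Finset.sum_range_succ, ← add_assoc]
    have hE : ∫⁻ ω, blockProduct φ g N j ω x * blockProduct φ g N j ω x'
        ∂Measure.infinitePi (fun _ : ℕ => ν) ≤ (M j : ℝ≥0∞) ^ 2 := by
      calc _ ≤ ∫⁻ ω, (M j : ℝ≥0∞) ^ 2 ∂Measure.infinitePi (fun _ : ℕ => ν) := by
            refine lintegral_mono fun ω => ?_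
            rw [sq]
            exact mul_le_mul' (hM j ω x) (hM j ω x')
        _ = _ := by simp
    have hu' : u.Nonempty := by simpa [u] using hN (Nat.lt_succ_self j)
    calc _ ≤ _ * (1 + blockExcess ν φ g u x x') := by
          gcongr
          exact lintegral_blockDensity_mul_le ν hφ0 hφ hg hmean hu' x x'
      _ ≤ _ := by
          rw [mul_add, mul_one]
          gcongr

theorem lintegral_energy_blockProduct_le (m : Measure X) [SFinite m] (hφ0 : ∀ n, φ n ≠ 0)
    (hφ : ∀ n, φ n ≠ ⊤)
    (hg : ∀ n, Measurable (Function.uncurry (g n))) (hmean : ∀ n x, ∫⁻ y, g n y x ∂ν = 1)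
    (hN : StrictMono N) {M : ℕ → ℝ≥0} (hM : ∀ j ω x, blockProduct φ g N j ω x ≤ M j)
    {K : X → X → ℝ≥0∞} (hK : Measurable (Function.uncurry K)) {C : ℝ≥0∞}
    (hC : ∀ n, ∫⁻ y, ∫⁻ x, ∫⁻ x', K x x' * (g n y x * g n y x') ∂m ∂m ∂ν ≤ C / φ n)
    {ε : ℕ → ℝ≥0∞}
    (hε : ∀ j, (M j : ℝ≥0∞) ^ 2 * (C / ∑ i ∈ Finset.Ico (N j) (N (j + 1)), φ i) ≤ ε j) (j : ℕ) :
    ∫⁻ ω, ∫⁻ x, ∫⁻ x', K x x' * (blockProduct φ g N j ω x * blockProduct φ g N j ω x') ∂m ∂m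
      ∂Measure.infinitePi (fun _ : ℕ => ν) ≤ ∫⁻ x, ∫⁻ x', K x x' ∂m ∂m + ∑' i, ε i := by
  rw [← lintegral_mul_expectation _ m hK (measurable_blockProduct hg j)]
  have hKx : ∀ x, Measurable (K x) := fun x => hK.comp measurable_prodMk_left
  have hG : ∀ i, Measurable fun p : X × X => K p.1 p.2 *
      blockExcess ν φ g (Finset.Ico (N i) (N (i + 1))) p.1 p.2 := fun i =>
    hK.mul (measurable_blockExcess ν hg _)
  have hGx : ∀ i x, Measurable fun x' => K x x' *
      blockExcess ν φ g (Finset.Ico (N i) (N (i + 1))) x x' := fun i x =>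
    (hG i).comp measurable_prodMk_left
  calc _ ≤ ∫⁻ x, ∫⁻ x', K x x' + ∑ i ∈ Finset.range j, (M i : ℝ≥0∞) ^ 2 * (K x x' *
          blockExcess ν φ g (Finset.Ico (N i) (N (i + 1))) x x') ∂m ∂m := by
        refine lintegral_mono fun x => lintegral_mono fun x' => ?_
        refine (mul_le_mul_right (lintegral_blockProduct_mul_le ν hφ0 hφ hg hmean hN hM j x x')
          _).trans_eq ?_
        rw [mul_add, mul_one, Finset.mul_sum]
        congr 1
        exact Finset.sum_congr rfl fun i _ => by ring
    _ = ∫⁻ x, ∫⁻ x', K x x' ∂m ∂m + ∑ i ∈ Finset.range j, (M i : ℝ≥0∞) ^ 2 *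
          ∫⁻ x, ∫⁻ x', K x x' * blockExcess ν φ g (Finset.Ico (N i) (N (i + 1))) x x' ∂m ∂m := by
        have h1 : ∀ x, ∫⁻ x', K x x' + ∑ i ∈ Finset.range j, (M i : ℝ≥0∞) ^ 2 * (K x x' *
            blockExcess ν φ g (Finset.Ico (N i) (N (i + 1))) x x') ∂m = ∫⁻ x', K x x' ∂m +
            ∑ i ∈ Finset.range j, (M i : ℝ≥0∞) ^ 2 *
              ∫⁻ x', K x x' * blockExcess ν φ g (Finset.Ico (N i) (N (i + 1))) x x' ∂m := by
          intro x
          rw [lintegral_add_left (hKx x), lintegral_finsetSum _ fun i _ => (hGx i x).const_mul _]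
          congr 1
          exact Finset.sum_congr rfl fun i _ => lintegral_const_mul _ (hGx i x)
        simp only [h1]
        have hKi : Measurable fun x => ∫⁻ x', K x x' ∂m := hK.lintegral_prod_right'
        rw [lintegral_add_left hKi,
          lintegral_finsetSum _ fun i _ => ((hG i).lintegral_prod_right').const_mul _]
        congr 1
        exact Finset.sum_congr rfl fun i _ => lintegral_const_mul _ (hG i).lintegral_prod_right'
    _ ≤ ∫⁻ x, ∫⁻ x', K x x' ∂m ∂m + ∑' i, ε i := by
        gcongr
        refine (Finset.sum_le_sum fun i _ => ?_).trans (ENNReal.sum_le_tsum (Finset.range j))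
        refine le_trans ?_ (hε i)
        gcongr
        exact lintegral_blockExcess_le ν m hφ0 hφ hg hK hC
          (by simpa using hN (Nat.lt_succ_self i))

/-- A random construction: with probability close to one, infinitely many of the products of
block densities have mass bounded from below and energy bounded from above. -/
theorem exists_blockProduct_frequently (m : Measure X) [IsFiniteMeasure m] (hm : m univ ≠ 0)
    (hφ0 : ∀ n, φ n ≠ 0) (hφ : ∀ n, φ n ≠ ⊤) (hsum : ∑' n, φ n = ⊤)
    (hg : ∀ n, Measurable (Function.uncurry (g n))) (hmean : ∀ n x, ∫⁻ y, g n y x ∂ν = 1)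
    (hbdd : ∀ n, ∃ b : ℝ≥0, ∀ y x, g n y x ≤ b)
    {K : X → X → ℝ≥0∞} (hK : Measurable (Function.uncurry K)) (hK1 : ∀ x x', 1 ≤ K x x')
    (hKfin : ∫⁻ x, ∫⁻ x', K x x' ∂m ∂m ≠ ⊤) {C : ℝ≥0∞} (hCtop : C ≠ ⊤)
    (hC : ∀ n, ∫⁻ y, ∫⁻ x, ∫⁻ x', K x x' * (g n y x * g n y x') ∂m ∂m ∂ν ≤ C / φ n)
    {η : ℝ≥0∞} (hη : η ≠ 0) :
    ∃ (N : ℕ → ℕ) (δ E : ℝ≥0∞), StrictMono N ∧ δ ≠ 0 ∧ E ≠ ⊤ ∧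
      Measure.infinitePi (fun _ : ℕ => ν) {ω | ¬ ∃ᶠ j in atTop,
        δ ≤ ∫⁻ x, blockProduct φ g N j ω x ∂m ∧
        ∫⁻ x, ∫⁻ x', K x x' * (blockProduct φ g N j ω x * blockProduct φ g N j ω x') ∂m ∂m
          ≤ E} ≤ η := by
  wlog hηtop : η ≠ ⊤ generalizing η
  · obtain ⟨N, δ, E, h1, h2, h3, h4⟩ := this one_ne_zero ENNReal.one_ne_top
    refine ⟨N, δ, E, h1, h2, h3, ?_⟩
    rw [not_ne_iff.1 hηtop]; exact le_top
  set a := m univ with ha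
  have hatop : a ≠ ⊤ := measure_ne_top m _
  have ha2 : (a / 2) ^ 2 ≠ 0 := pow_ne_zero _ (ENNReal.half_pos hm).ne'
  have ha2top : (a / 2) ^ 2 ≠ ⊤ := ENNReal.pow_ne_top (ENNReal.div_ne_top hatop two_ne_zero)
  -- Chebyshev bounds `(a / 2) ^ 2` times the probability of mass below `a / 2` by `κ`, so that
  -- probability is at most `η / 2`.
  set κ := (a / 2) ^ 2 * (η / 2) with hκ
  have hκ0 : κ ≠ 0 := mul_ne_zero ha2 (ENNReal.half_pos hη).ne'
  obtain ⟨ε, hε0, hεsum⟩ := ENNReal.exists_pos_sum_of_countable' hκ0 ℕ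
  have hb : ∀ N N', ∃ b : ℝ≥0, ∀ ω x, blockDensity φ g (Finset.Ico N N') ω x ≤ b :=
    fun N N' => exists_blockDensity_le hbdd _
  choose b hb using hb
  obtain ⟨N, M, hN, hM0, hMs, hMε⟩ := exists_blocks hφ hsum hCtop b fun j => (hε0 j).ne'
  have hM : ∀ j ω x, blockProduct φ g N j ω x ≤ M j := by
    intro j ω x
    induction j with
    | zero => simp [blockProduct, hM0]
    | succ j ih =>
      rw [blockProduct, Finset.prod_range_succ, hMs, ENNReal.coe_mul]
      exact mul_le_mul' ih (hb _ _ _ _)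
  set P := Measure.infinitePi (fun _ : ℕ => ν) with hP
  set B := ∫⁻ x, ∫⁻ x', K x x' ∂m ∂m + κ with hB
  have hκtop : κ ≠ ⊤ := ENNReal.mul_ne_top ha2top (ENNReal.div_ne_top hηtop two_ne_zero)
  have hBtop : B ≠ ⊤ := ENNReal.add_ne_top.2 ⟨hKfin, hκtop⟩
  have hFm := fun j => measurable_blockProduct (φ := φ) (N := N) hg j
  have hFmx : ∀ j ω, Measurable fun x => blockProduct φ g N j ω x := fun j ω =>
    (hFm j).comp measurable_prodMk_left
  set Z : ℕ → (ℕ → Y) → ℝ≥0∞ := fun j ω => ∫⁻ x, blockProduct φ g N j ω x ∂m with hZ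
  set V : ℕ → (ℕ → Y) → ℝ≥0∞ := fun j ω =>
    ∫⁻ x, ∫⁻ x', K x x' * (blockProduct φ g N j ω x * blockProduct φ g N j ω x') ∂m ∂m with hV
  have hZm : ∀ j, Measurable (Z j) := fun j => (hFm j).lintegral_prod_right'
  have hVm : ∀ j, Measurable (V j) := by
    intro j
    have h3 : Measurable fun q : ((ℕ → Y) × X) × X => K q.1.2 q.2 *
        (blockProduct φ g N j q.1.1 q.1.2 * blockProduct φ g N j q.1.1 q.2) :=
      (hK.comp ((measurable_snd.comp measurable_fst).prodMk measurable_snd)).mul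
        (((hFm j).comp measurable_fst).mul
          ((hFm j).comp ((measurable_fst.comp measurable_fst).prodMk measurable_snd)))
    exact (Measurable.lintegral_prod_right' h3).lintegral_prod_right'
  have hZ1 : ∀ j, ∫⁻ ω, Z j ω ∂P = a := by
    intro j
    change ∫⁻ ω, ∫⁻ x, blockProduct φ g N j ω x ∂m ∂P = a
    rw [lintegral_lintegral_swap (hFm j).aemeasurable]
    have h1 : ∀ x, ∫⁻ ω, blockProduct φ g N j ω x ∂P = 1 :=
      lintegral_blockProduct ν hφ0 hφ hg hmean hN j
    simp [h1, ha]
  have hZ2 : ∀ j, ∫⁻ ω, Z j ω ^ 2 ∂P ≤ a ^ 2 + κ := by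
    intro j
    -- The second moment of the mass is the energy for the kernel `1`. Since `1 ≤ K`, the same
    -- constant `C` and the same blocks serve.
    have hle := lintegral_energy_blockProduct_le ν m hφ0 hφ hg hmean hN hM (K := fun _ _ => 1)
      measurable_const (C := C) (fun n => (lintegral_mono fun y => lintegral_mono fun x =>
        lintegral_mono fun x' => mul_le_mul_left (hK1 x x') _).trans (hC n)) hMε j
    have h2 : ∀ ω, Z j ω ^ 2 = ∫⁻ x, ∫⁻ x', 1 *
        (blockProduct φ g N j ω x * blockProduct φ g N j ω x') ∂m ∂m := by
      intro ω
      simp only [one_mul]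
      rw [sq, hZ, ← lintegral_mul_const _ (hFmx j ω)]
      exact lintegral_congr fun x => (lintegral_const_mul _ (hFmx j ω)).symm
    simp only [h2]
    refine hle.trans (add_le_add ?_ hεsum.le)
    simp [ha, sq]
  have hV1 : ∀ j, ∫⁻ ω, V j ω ∂P ≤ B := fun j =>
    (lintegral_energy_blockProduct_le ν m hφ0 hφ hg hmean hN hM hK hC hMε j).trans
      (add_le_add_right hεsum.le _)
  have hη2 : η / 2 ≠ 0 := (ENNReal.half_pos hη).ne'
  have hη2top : η / 2 ≠ ⊤ := ENNReal.div_ne_top hηtop two_ne_zero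
  have hB0 : B ≠ 0 := fun h => hκ0 (add_eq_zero.1 h).2
  -- `B` bounds the mean energy, so Markov's inequality makes energy at least `B / (η / 2)` have
  -- probability at most `η / 2`.
  refine ⟨N, a / 2, B / (η / 2), hN, (ENNReal.half_pos hm).ne', ENNReal.div_ne_top hBtop hη2, ?_⟩
  have hsub : {ω | ¬ ∃ᶠ j in atTop, a / 2 ≤ Z j ω ∧ V j ω ≤ B / (η / 2)} ⊆
      {ω | ∀ᶠ j in atTop, ω ∈ {ω | Z j ω < a / 2} ∪ {ω | B / (η / 2) ≤ V j ω}} := by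
    intro ω hω
    refine (not_frequently.1 hω).mono fun j hj => ?_
    by_contra hcon
    simp only [mem_union, mem_ofPred_eq, not_or, not_lt, not_le] at hcon
    exact hj ⟨hcon.1, hcon.2.le⟩
  refine (measure_mono hsub).trans (measure_eventually_notMem_le P fun j => ?_)
  refine (measure_union_le _ _).trans ?_
  refine (add_le_add ?_ ?_).trans (ENNReal.add_halves η).le
  · have := sq_mul_measure_lt_half_le P (hZm j) hatop (hZ1 j) (hZ2 j)
    exact (ENNReal.mul_le_mul_iff_right ha2 ha2top).1 this
  · refine (meas_ge_le_lintegral_div (hVm j).aemeasurable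
      (ENNReal.div_pos hB0 hη2top).ne' (ENNReal.div_ne_top hBtop hη2)).trans ?_
    refine ENNReal.div_le_of_le_mul ((hV1 j).trans_eq ?_)
    rw [ENNReal.mul_div_cancel hη2 hη2top]

end BlockProducts

/-! ### Integrable power singularities on the line -/

section PowerSingularities

theorem lintegral_Icc_rpow_lt_top {κ : ℝ} (hκ : κ < 1) :
    ∫⁻ x in Icc (0 : ℝ) 1, ENNReal.ofReal x ^ (-κ) < ⊤ := by
  have hint : IntegrableOn (fun x : ℝ => x ^ (-κ)) (Ioc 0 1) :=
    (intervalIntegrable_iff_integrableOn_Ioc_of_le zero_le_one).1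
      (intervalIntegral.intervalIntegrable_rpow' (by linarith))
  rw [setLIntegral_congr Ioc_ae_eq_Icc.symm]
  calc _ = ∫⁻ x in Ioc (0 : ℝ) 1, ENNReal.ofReal (x ^ (-κ)) :=
        setLIntegral_congr_fun measurableSet_Ioc fun x hx => ENNReal.ofReal_rpow_of_pos hx.1
    _ < ⊤ := hint.lintegral_lt_top

/-- Translates of `|x|^(-κ)`, `κ < 1`, have uniformly bounded integrals over an interval. -/
theorem exists_lintegral_abs_sub_rpow_le {κ : ℝ} (h0 : 0 ≤ κ) (hκ : κ < 1) (L : ℝ) :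
    ∃ C : ℝ≥0∞, C ≠ ⊤ ∧ 1 ≤ C ∧
      ∀ c : ℝ, ∫⁻ x in Icc (-L) L, ENNReal.ofReal |x - c| ^ (-κ) ≤ C := by
  set f : ℝ → ℝ≥0∞ := (Icc (0 : ℝ) 1).indicator fun x => ENNReal.ofReal x ^ (-κ) with hf
  have hfm : Measurable f := Measurable.indicator (by fun_prop) measurableSet_Icc
  have hfi : ∫⁻ x, f x < ⊤ := by
    rw [hf, lintegral_indicator measurableSet_Icc]; exact lintegral_Icc_rpow_lt_top hκ
  refine ⟨(∫⁻ x, f x) + (∫⁻ x, f x) + volume (Icc (-L) L) + 1, ?_, le_add_self, fun c => ?_⟩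
  · simp [hfi.ne]
  -- The two copies of `f` cover the points within distance `1` on either side of `c`; farther away
  -- the power is at most `1`.
  have hpt : ∀ x, ENNReal.ofReal |x - c| ^ (-κ) ≤ f (x - c) + f (c - x) + 1 := by
    intro x
    by_cases hx : |x - c| ≤ 1
    · rcases le_total c x with h | h
      · have h1 : x - c ∈ Icc (0 : ℝ) 1 := ⟨by linarith, (le_abs_self _).trans hx⟩
        rw [abs_of_nonneg h1.1]
        have : f (x - c) = ENNReal.ofReal (x - c) ^ (-κ) := indicator_of_mem h1 _
        rw [← this, add_assoc]
        exact le_self_add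
      · have h1 : c - x ∈ Icc (0 : ℝ) 1 :=
          ⟨by linarith, by rw [abs_sub_comm] at hx; exact (le_abs_self _).trans hx⟩
        rw [abs_sub_comm, abs_of_nonneg h1.1]
        have : f (c - x) = ENNReal.ofReal (c - x) ^ (-κ) := indicator_of_mem h1 _
        rw [← this, add_comm (f (x - c)), add_assoc]
        exact le_self_add
    · refine le_trans ?_ le_add_self
      rw [ENNReal.rpow_neg]
      refine ENNReal.inv_le_one.2 ?_
      rw [← ENNReal.one_rpow κ]
      refine ENNReal.rpow_le_rpow ?_ h0
      rw [← ENNReal.ofReal_one]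
      exact ENNReal.ofReal_le_ofReal (not_le.1 hx).le
  calc _ ≤ ∫⁻ x in Icc (-L) L, (f (x - c) + f (c - x) + 1) := lintegral_mono fun x => hpt x
    _ = (∫⁻ x in Icc (-L) L, (f (x - c) + f (c - x))) + volume (Icc (-L) L) := by
        rw [lintegral_add_right _ measurable_const, setLIntegral_one]
    _ ≤ (∫⁻ x, (f (x - c) + f (c - x))) + volume (Icc (-L) L) := by
        gcongr; exact Measure.restrict_le_self
    _ = (∫⁻ x, f x) + (∫⁻ x, f x) + volume (Icc (-L) L) := by
        rw [lintegral_add_left (by fun_prop), lintegral_sub_right_eq_self f c,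
          lintegral_sub_left_eq_self f c]
    _ ≤ _ := le_self_add

theorem lintegral_abs_affine_rpow_le {κ : ℝ} {L : ℝ} {C : ℝ≥0∞} (h0 : 0 ≤ κ) (hC1 : 1 ≤ C)
    (hC : ∀ c : ℝ, ∫⁻ x in Icc (-L) L, ENNReal.ofReal |x - c| ^ (-κ) ≤ C) (e v : ℝ) :
    ∫⁻ x in Icc (-L) L, ENNReal.ofReal |e - v * x| ^ (-κ) ≤ ENNReal.ofReal |v| ^ (-κ) * C := by
  -- For `v = 0` and `κ > 0` the right side is `⊤ * C`, which is `⊤` because `C ≠ 0`; for `v ≠ 0`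
  -- factor out `|v|`.
  rcases eq_or_ne v 0 with rfl | hv
  · rcases h0.eq_or_lt with rfl | hpos
    · simpa using hC 0
    · rw [abs_zero, ENNReal.ofReal_zero, ENNReal.zero_rpow_of_neg (by linarith),
        ENNReal.top_mul (by positivity)]
      exact le_top
  · have h : ∀ x, ENNReal.ofReal |e - v * x| ^ (-κ) =
        ENNReal.ofReal |v| ^ (-κ) * ENNReal.ofReal |x - e / v| ^ (-κ) := by
      intro x
      rw [← ENNReal.mul_rpow_of_ne_top ENNReal.ofReal_ne_top ENNReal.ofReal_ne_top,
        ← ENNReal.ofReal_mul (abs_nonneg v), ← abs_mul, mul_sub, mul_div_cancel₀ _ hv, abs_sub_comm]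
    simp only [h]
    rw [lintegral_const_mul _ (by fun_prop)]
    gcongr
    exact hC _

end PowerSingularities

/-! ### Coordinates, Lebesgue measure and rectangles in the Heisenberg group -/

namespace Heisenberg

theorem continuous_x : Continuous fun p : Heisenberg => p.x :=
  continuous_fst.comp coordinates.continuous

theorem continuous_y : Continuous fun p : Heisenberg => p.y :=
  (continuous_fst.comp continuous_snd).comp coordinates.continuous

theorem continuous_z : Continuous fun p : Heisenberg => p.z :=
  (continuous_snd.comp continuous_snd).comp coordinates.continuous

theorem continuous_mk {Z : Type*} [TopologicalSpace Z] {f g h : Z → ℝ} (hf : Continuous f)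
    (hg : Continuous g) (hh : Continuous h) : Continuous fun t => (⟨f t, g t, h t⟩ : Heisenberg) :=
  coordinates.symm.continuous.comp (hf.prodMk (hg.prodMk hh))

instance : SecondCountableTopology Heisenberg :=
  coordinates.isEmbedding.secondCountableTopology

theorem measurable_x : Measurable fun p : Heisenberg => p.x := continuous_x.measurable

theorem abs_x_le_gauge (p : Heisenberg) : |p.x| ≤ p.gauge :=
  (Complex.abs_re_le_norm ⟨p.x, p.y⟩).trans p.norm_horizontal_le

theorem abs_y_le_gauge (p : Heisenberg) : |p.y| ≤ p.gauge :=
  (Complex.abs_im_le_norm ⟨p.x, p.y⟩).trans p.norm_horizontal_le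

theorem abs_z_le_gauge_sq (p : Heisenberg) : |p.z| ≤ p.gauge ^ 2 := by
  rw [gauge_sq_eq_norm]
  exact Complex.abs_im_le_norm ⟨p.x ^ 2 + p.y ^ 2, p.z⟩

theorem edist_eq (p q : Heisenberg) : edist p q = ENNReal.ofReal (p⁻¹ * q).gauge := by
  rw [edist_dist, dist_def]

theorem edist_rpow_le_x (p q : Heisenberg) {κ : ℝ} (h : 0 ≤ κ) :
    edist p q ^ (-κ) ≤ ENNReal.ofReal |q.x - p.x| ^ (-κ) := by
  rw [ENNReal.rpow_neg, ENNReal.rpow_neg, ENNReal.inv_le_inv]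
  refine ENNReal.rpow_le_rpow ?_ h
  rw [edist_eq]
  refine ENNReal.ofReal_le_ofReal (le_trans (le_of_eq ?_) (abs_x_le_gauge _))
  simp only [mul_x, inv_x]; congr 1; ring

theorem edist_rpow_le_y (p q : Heisenberg) {κ : ℝ} (h : 0 ≤ κ) :
    edist p q ^ (-κ) ≤ ENNReal.ofReal |q.y - p.y| ^ (-κ) := by
  rw [ENNReal.rpow_neg, ENNReal.rpow_neg, ENNReal.inv_le_inv]
  refine ENNReal.rpow_le_rpow ?_ h
  rw [edist_eq]
  refine ENNReal.ofReal_le_ofReal (le_trans (le_of_eq ?_) (abs_y_le_gauge _))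
  simp only [mul_y, inv_y]; congr 1; ring

/-- The vertical coordinate has homogeneity two, so one integrable singularity in `z` absorbs twice
the exponent that a horizontal one does. -/
theorem edist_rpow_le_z (p q : Heisenberg) {κ : ℝ} (h : 0 ≤ κ) :
    edist p q ^ (-(2 * κ)) ≤
      ENNReal.ofReal |q.z - (p.z + 2 * (p.x * q.y - p.y * q.x))| ^ (-κ) := by
  rw [ENNReal.rpow_neg, ENNReal.rpow_neg, ENNReal.inv_le_inv, ENNReal.rpow_mul]
  refine ENNReal.rpow_le_rpow ?_ h
  rw [edist_eq, ENNReal.ofReal_rpow_of_nonneg (gauge_nonneg _) zero_le_two, Real.rpow_two]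
  refine ENNReal.ofReal_le_ofReal (le_trans (le_of_eq ?_) (abs_z_le_gauge_sq _))
  simp only [mul_z, inv_x, inv_y, inv_z]; congr 1; ring

instance : SFinite (volume : Measure Heisenberg) :=
  inferInstanceAs (SFinite ((volume : Measure (ℝ × ℝ × ℝ)).map coordinates.symm))

theorem measurable_mk : Measurable fun v : ℝ × ℝ × ℝ => (⟨v.1, v.2.1, v.2.2⟩ : Heisenberg) :=
  coordinates.symm.continuous.measurable

theorem lintegral_eq {f : Heisenberg → ℝ≥0∞} (hf : Measurable f) :
    ∫⁻ q, f q = ∫⁻ x, ∫⁻ y, ∫⁻ z, f ⟨x, y, z⟩ := by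
  change ∫⁻ q, f q ∂(volume : Measure (ℝ × ℝ × ℝ)).map coordinates.symm = _
  have hm : Measurable fun v : ℝ × ℝ × ℝ => f ⟨v.1, v.2.1, v.2.2⟩ := hf.comp measurable_mk
  rw [lintegral_map hf coordinates.symm.continuous.measurable]
  change ∫⁻ v : ℝ × ℝ × ℝ, f ⟨v.1, v.2.1, v.2.2⟩ = _
  rw [Measure.volume_eq_prod, lintegral_prod _ hm.aemeasurable]
  refine lintegral_congr fun x => ?_
  have hx : Measurable fun v : ℝ × ℝ => f ⟨x, v.1, v.2⟩ := hm.comp measurable_prodMk_left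
  rw [Measure.volume_eq_prod]
  exact lintegral_prod _ hx.aemeasurable

/-- A left translation is a Euclidean translation composed with a shear in `z`: for fixed `x` and
`y` it only translates `z`. -/
theorem lintegral_mul_left {f : Heisenberg → ℝ≥0∞} (hf : Measurable f) (p : Heisenberg) :
    ∫⁻ q, f (p * q) = ∫⁻ q, f q := by
  have hmul : Measurable fun q : Heisenberg => p * q := by
    have : Continuous fun q : Heisenberg => p * q :=
      continuous_mk (continuous_const.add continuous_x) (continuous_const.add continuous_y)
        ((continuous_const.add continuous_z).add (continuous_const.mul
          ((continuous_const.mul continuous_y).sub (continuous_const.mul continuous_x))))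
    exact this.measurable
  rw [lintegral_eq (f := fun q => f (p * q)) (hf.comp hmul), lintegral_eq hf]
  calc _ = ∫⁻ x, ∫⁻ y, ∫⁻ z, f ⟨p.x + x, p.y + y, z⟩ := by
        refine lintegral_congr fun x => lintegral_congr fun y => ?_
        rw [← lintegral_add_left_eq_self (fun z => f ⟨p.x + x, p.y + y, z⟩)
          (p.z + 2 * (p.x * y - p.y * x))]
        refine lintegral_congr fun z => ?_
        congr 1
        ext
        · rfl
        · rfl
        · simp only [mul_z]; ring
    _ = ∫⁻ x, ∫⁻ y, ∫⁻ z, f ⟨p.x + x, y, z⟩ :=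
        lintegral_congr fun x =>
          lintegral_add_left_eq_self (fun y => ∫⁻ z, f ⟨p.x + x, y, z⟩) p.y
    _ = _ := lintegral_add_left_eq_self (fun x => ∫⁻ y, ∫⁻ z, f ⟨x, y, z⟩) p.x

theorem mem_rectangle {p q : Heisenberg} {r : ℝ × ℝ} :
    q ∈ rectangle p r ↔
      (p⁻¹ * q).x ^ 2 + (p⁻¹ * q).y ^ 2 ≤ r.1 ^ 2 ∧ |(p⁻¹ * q).z| ≤ r.2 ^ 2 := by
  constructor
  · rintro ⟨h, hh, rfl⟩
    simpa using hh
  · intro h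
    exact ⟨p⁻¹ * q, h, by simp⟩

/-- The rectangle at the identity is invariant under inversion. This lets the randomness of the
centre be read as the `ν`-measure of a rectangle around the fixed point. -/
theorem mem_rectangle_comm {p q : Heisenberg} {r : ℝ × ℝ} :
    q ∈ rectangle p r ↔ p ∈ rectangle q r := by
  have h : q⁻¹ * p = (p⁻¹ * q)⁻¹ := by simp
  rw [mem_rectangle, mem_rectangle, h]
  simp only [inv_x, inv_y, inv_z, neg_sq, abs_neg]

theorem mul_mem_rectangle {p h q : Heisenberg} {r : ℝ × ℝ} :
    p * h ∈ rectangle (p * q) r ↔ h ∈ rectangle q r := by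
  rw [mem_rectangle, mem_rectangle]
  simp [mul_assoc]

theorem isClosed_rectangles (r : ℝ × ℝ) :
    IsClosed {v : Heisenberg × Heisenberg | v.2 ∈ rectangle v.1 r} := by
  simp only [mem_rectangle, mul_x, mul_y, mul_z, inv_x, inv_y, inv_z]
  have h1x := continuous_x.comp (continuous_fst (X := Heisenberg) (Y := Heisenberg))
  have h1y := continuous_y.comp (continuous_fst (X := Heisenberg) (Y := Heisenberg))
  have h1z := continuous_z.comp (continuous_fst (X := Heisenberg) (Y := Heisenberg))
  have h2x := continuous_x.comp (continuous_snd (X := Heisenberg) (Y := Heisenberg))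
  have h2y := continuous_y.comp (continuous_snd (X := Heisenberg) (Y := Heisenberg))
  have h2z := continuous_z.comp (continuous_snd (X := Heisenberg) (Y := Heisenberg))
  refine (isClosed_le ?_ continuous_const).and (isClosed_le ?_ continuous_const)
  · exact ((h1x.neg.add h2x).pow 2).add ((h1y.neg.add h2y).pow 2)
  · exact ((h1z.neg.add h2z).add
      (continuous_const.mul ((h1x.neg.mul h2y).sub (h1y.neg.mul h2x)))).abs

theorem isClosed_rectangle (p : Heisenberg) (r : ℝ × ℝ) : IsClosed (rectangle p r) :=
  (isClosed_rectangles r).preimage (Continuous.prodMk_right p)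

theorem box_of_mem_rectangle_one {q : Heisenberg} {r : ℝ × ℝ} (h1 : 0 ≤ r.1)
    (h : q ∈ rectangle 1 r) :
    q.x ∈ Icc (-r.1) r.1 ∧ q.y ∈ Icc (-r.1) r.1 ∧ q.z ∈ Icc (-r.2 ^ 2) (r.2 ^ 2) := by
  rw [mem_rectangle, inv_one, one_mul] at h
  refine ⟨abs_le.1 (abs_le_of_sq_le_sq ?_ h1), abs_le.1 (abs_le_of_sq_le_sq ?_ h1), abs_le.1 h.2⟩
  · nlinarith [sq_nonneg q.y, h.1]
  · nlinarith [sq_nonneg q.x, h.1]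

theorem setLIntegral_rectangle_le {f : Heisenberg → ℝ≥0∞} (hf : Measurable f) {r : ℝ × ℝ}
    (h1 : 0 ≤ r.1) :
    ∫⁻ q in rectangle 1 r, f q ≤ ∫⁻ x in Icc (-r.1) r.1, ∫⁻ y in Icc (-r.1) r.1,
      ∫⁻ z in Icc (-r.2 ^ 2) (r.2 ^ 2), f ⟨x, y, z⟩ := by
  have hm := (isClosed_rectangle 1 r).measurableSet
  rw [← lintegral_indicator hm, lintegral_eq (hf.indicator hm),
    ← lintegral_indicator measurableSet_Icc]
  refine lintegral_mono fun x => ?_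
  by_cases hx : x ∈ Icc (-r.1) r.1
  · rw [indicator_of_mem hx, ← lintegral_indicator measurableSet_Icc]
    refine lintegral_mono fun y => ?_
    by_cases hy : y ∈ Icc (-r.1) r.1
    · rw [indicator_of_mem hy, ← lintegral_indicator measurableSet_Icc]
      refine lintegral_mono fun z => ?_
      by_cases hz : z ∈ Icc (-r.2 ^ 2) (r.2 ^ 2)
      · rw [indicator_of_mem hz]; exact indicator_le_self _ _ _
      · rw [indicator_of_notMem fun h => hz (box_of_mem_rectangle_one h1 h).2.2]; exact zero_le
    · have : ∀ z, (rectangle 1 r).indicator f ⟨x, y, z⟩ = 0 := fun z =>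
        indicator_of_notMem (fun h => hy (box_of_mem_rectangle_one h1 h).2.1) _
      simp [this]
  · have : ∀ y z, (rectangle 1 r).indicator f ⟨x, y, z⟩ = 0 := fun y z =>
      indicator_of_notMem (fun h => hx (box_of_mem_rectangle_one h1 h).1) _
    simp [this]

/-- With `y` innermost, the twist term of the group law can be integrated in `y`; this serves the
exponent `3κ`. -/
theorem setLIntegral_rectangle_le_swap {f : Heisenberg → ℝ≥0∞} (hf : Measurable f) {r : ℝ × ℝ}
    (h1 : 0 ≤ r.1) :
    ∫⁻ q in rectangle 1 r, f q ≤ ∫⁻ x in Icc (-r.1) r.1, ∫⁻ z in Icc (-r.2 ^ 2) (r.2 ^ 2),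
      ∫⁻ y in Icc (-r.1) r.1, f ⟨x, y, z⟩ := by
  refine (setLIntegral_rectangle_le hf h1).trans_eq (lintegral_congr fun x => ?_)
  refine lintegral_lintegral_swap ?_
  exact (hf.comp (measurable_mk.comp (g := fun v : ℝ × ℝ × ℝ => (⟨v.1, v.2.1, v.2.2⟩ : Heisenberg))
    (f := fun v : ℝ × ℝ => (x, v)) measurable_prodMk_left)).aemeasurable

end Heisenberg

/-- As both exponents have the same sign, the values `0` and `⊤` need no exclusion, so the kernel
can be split on the diagonal too. -/
theorem ENNReal.rpow_neg_add_of_nonneg (x : ℝ≥0∞) {a b : ℝ} (ha : 0 ≤ a) (hb : 0 ≤ b) :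
    x ^ (-(a + b)) = x ^ (-a) * x ^ (-b) := by
  simp only [ENNReal.rpow_neg, ← ENNReal.inv_rpow]
  exact ENNReal.rpow_add_of_nonneg _ _ ha hb

/-! ### Energies of rectangles -/

namespace Heisenberg

/-- The `s`-energy of Lebesgue measure on a rectangle. -/
noncomputable def rectangleEnergy (s : ℝ) (r : ℝ × ℝ) : ℝ≥0∞ :=
  ∫⁻ p in rectangle 1 r, ∫⁻ q in rectangle 1 r, edist p q ^ (-s)

theorem measurable_edist_rpow (s : ℝ) :
    Measurable fun v : Heisenberg × Heisenberg => edist v.1 v.2 ^ s :=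
  measurable_edist.pow_const s

theorem measurable_edist_rpow_right (s : ℝ) (p : Heisenberg) :
    Measurable fun q : Heisenberg => edist p q ^ s :=
  measurable_edist_right.pow_const s

theorem lintegral_const_Icc {a : ℝ} (c : ℝ≥0∞) :
    ∫⁻ _ in Icc (-a) a, c = c * ENNReal.ofReal (2 * a) := by
  rw [setLIntegral_const, Real.volume_Icc]; congr 2; ring

theorem volume_rectangle_one_le {r : ℝ × ℝ} (h1 : 0 ≤ r.1) :
    volume (rectangle 1 r) ≤ ENNReal.ofReal (8 * (r.1 ^ 2 * r.2 ^ 2)) := by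
  rw [← setLIntegral_one]
  refine (setLIntegral_rectangle_le measurable_const h1).trans (le_of_eq ?_)
  simp only [lintegral_const_Icc, one_mul]
  rw [← ENNReal.ofReal_mul (by positivity), ← ENNReal.ofReal_mul (by positivity)]
  congr 1; ring

variable {r : ℝ × ℝ} {κ L : ℝ} {C : ℝ≥0∞}

theorem rectangleEnergy_zero_le (h1 : 0 ≤ r.1) :
    rectangleEnergy 0 r ≤ ENNReal.ofReal (64 * (r.1 ^ 4 * r.2 ^ 4)) := by
  unfold rectangleEnergy
  simp only [neg_zero, ENNReal.rpow_zero, setLIntegral_const, one_mul]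
  calc _ ≤ ENNReal.ofReal (8 * (r.1 ^ 2 * r.2 ^ 2)) * ENNReal.ofReal (8 * (r.1 ^ 2 * r.2 ^ 2)) :=
        mul_le_mul' (volume_rectangle_one_le h1) (volume_rectangle_one_le h1)
    _ = _ := by
        rw [← ENNReal.ofReal_mul (by positivity)]; congr 1; ring

theorem setLIntegral_Icc_le (hC : ∀ c : ℝ, ∫⁻ x in Icc (-L) L, ENNReal.ofReal |x - c| ^ (-κ) ≤ C)
    {ℓ : ℝ} (hℓ : ℓ ≤ L) (c : ℝ) : ∫⁻ x in Icc (-ℓ) ℓ, ENNReal.ofReal |x - c| ^ (-κ) ≤ C :=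
  (lintegral_mono_set (Icc_subset_Icc (neg_le_neg hℓ) hℓ)).trans (hC c)

/-- Only the vertical singularity is used. Integrating it out in `q.z` costs `C` in place of the
factor `r₂²`, and the other variables contribute their side lengths. -/
theorem rectangleEnergy_two_le (h1 : 0 ≤ r.1) (hr2 : r.2 ^ 2 ≤ L) (h0 : 0 ≤ κ)
    (hC : ∀ c : ℝ, ∫⁻ x in Icc (-L) L, ENNReal.ofReal |x - c| ^ (-κ) ≤ C) :
    rectangleEnergy (2 * κ) r ≤ ENNReal.ofReal (32 * (r.1 ^ 4 * r.2 ^ 2)) * C := by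
  have hp : ∀ p, ∫⁻ q in rectangle 1 r, edist p q ^ (-(2 * κ)) ≤
      C * ENNReal.ofReal (2 * r.1) * ENNReal.ofReal (2 * r.1) := by
    intro p
    refine (setLIntegral_rectangle_le (measurable_edist_rpow_right _ p) h1).trans ?_
    rw [← lintegral_const_Icc, ← lintegral_const_Icc]
    refine lintegral_mono fun x => lintegral_mono fun y => ?_
    exact (lintegral_mono fun z => edist_rpow_le_z p ⟨x, y, z⟩ h0).trans
      (setLIntegral_Icc_le hC hr2 (p.z + 2 * (p.x * y - p.y * x)))
  calc rectangleEnergy (2 * κ) r ≤ ∫⁻ p in rectangle 1 r,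
        C * ENNReal.ofReal (2 * r.1) * ENNReal.ofReal (2 * r.1) := lintegral_mono hp
    _ ≤ C * ENNReal.ofReal (2 * r.1) * ENNReal.ofReal (2 * r.1) *
        ENNReal.ofReal (8 * (r.1 ^ 2 * r.2 ^ 2)) := by
        rw [setLIntegral_const]; gcongr; exact volume_rectangle_one_le h1
    _ = _ := by
        rw [mul_assoc, mul_assoc, ← ENNReal.ofReal_mul (by positivity),
          ← ENNReal.ofReal_mul (by positivity), mul_comm]
        congr 2; ring

/-- The exponent splits as `κ + κ + 2κ` among `x`, `y`, `z`. All three integrations in `q` cost `C`,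
and only the volume factor of `p` remains. -/
theorem rectangleEnergy_four_le (h1 : 0 ≤ r.1) (hr1 : r.1 ≤ L) (hr2 : r.2 ^ 2 ≤ L) (h0 : 0 ≤ κ)
    (hC : ∀ c : ℝ, ∫⁻ x in Icc (-L) L, ENNReal.ofReal |x - c| ^ (-κ) ≤ C) :
    rectangleEnergy (4 * κ) r ≤ ENNReal.ofReal (8 * (r.1 ^ 2 * r.2 ^ 2)) * C ^ 3 := by
  have hp : ∀ p, ∫⁻ q in rectangle 1 r, edist p q ^ (-(4 * κ)) ≤ C ^ 3 := by
    intro p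
    have hsplit : ∀ q : Heisenberg, edist p q ^ (-(4 * κ)) ≤ ENNReal.ofReal |q.x - p.x| ^ (-κ) *
        (ENNReal.ofReal |q.y - p.y| ^ (-κ) *
          ENNReal.ofReal |q.z - (p.z + 2 * (p.x * q.y - p.y * q.x))| ^ (-κ)) := by
      intro q
      rw [show 4 * κ = κ + (κ + 2 * κ) by ring,
        ENNReal.rpow_neg_add_of_nonneg _ h0 (by positivity),
        ENNReal.rpow_neg_add_of_nonneg _ h0 (by positivity)]
      exact mul_le_mul' (edist_rpow_le_x p q h0)
        (mul_le_mul' (edist_rpow_le_y p q h0) (edist_rpow_le_z p q h0))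
    refine (setLIntegral_rectangle_le (measurable_edist_rpow_right _ p) h1).trans ?_
    calc _ ≤ ∫⁻ x in Icc (-r.1) r.1, ENNReal.ofReal |x - p.x| ^ (-κ) * (C * C) := by
          refine lintegral_mono fun x => ?_
          calc _ ≤ ∫⁻ y in Icc (-r.1) r.1, ENNReal.ofReal |x - p.x| ^ (-κ) *
                (ENNReal.ofReal |y - p.y| ^ (-κ) * C) := by
                refine lintegral_mono fun y => ?_
                refine (lintegral_mono fun z => hsplit ⟨x, y, z⟩).trans ?_
                dsimp only
                rw [lintegral_const_mul _ (by fun_prop), lintegral_const_mul _ (by fun_prop)]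
                gcongr
                exact setLIntegral_Icc_le hC hr2 _
            _ ≤ _ := by
                rw [lintegral_const_mul _ (by fun_prop), lintegral_mul_const _ (by fun_prop)]
                gcongr
                exact setLIntegral_Icc_le hC hr1 _
      _ ≤ C * (C * C) := by
          rw [lintegral_mul_const _ (by fun_prop)]
          gcongr
          exact setLIntegral_Icc_le hC hr1 _
      _ = C ^ 3 := by ring
  calc rectangleEnergy (4 * κ) r ≤ ∫⁻ p in rectangle 1 r, C ^ 3 := lintegral_mono hp
    _ ≤ C ^ 3 * ENNReal.ofReal (8 * (r.1 ^ 2 * r.2 ^ 2)) := by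
        rw [setLIntegral_const]; gcongr; exact volume_rectangle_one_le h1
    _ = _ := mul_comm _ _

/-- The exponent splits as `κ + 2κ`. The vertical coordinate of `p⁻¹ * q` is affine in `q.y` with
slope `-2 * p.x`, so the twist lets the vertical singularity be integrated in `q.y` instead of
`q.z`. The price `|2 * p.x| ^ (-κ)` is itself integrable over `p`. -/
theorem rectangleEnergy_three_le (h1 : 0 ≤ r.1) (hr1 : r.1 ≤ L) (h0 : 0 ≤ κ) (hC1 : 1 ≤ C)
    (hC : ∀ c : ℝ, ∫⁻ x in Icc (-L) L, ENNReal.ofReal |x - c| ^ (-κ) ≤ C) :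
    rectangleEnergy (3 * κ) r ≤ ENNReal.ofReal (8 * (r.1 * r.2 ^ 4)) * C ^ 3 := by
  have hlin : ∀ e v : ℝ, ∫⁻ y in Icc (-r.1) r.1, ENNReal.ofReal |e - v * y| ^ (-κ) ≤
      ENNReal.ofReal |v| ^ (-κ) * C :=
    lintegral_abs_affine_rpow_le h0 hC1 (setLIntegral_Icc_le hC hr1)
  have hp : ∀ p, ∫⁻ q in rectangle 1 r, edist p q ^ (-(3 * κ)) ≤
      C * (ENNReal.ofReal |0 - 2 * p.x| ^ (-κ) * C * ENNReal.ofReal (2 * r.2 ^ 2)) := by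
    intro p
    have hsplit : ∀ q : Heisenberg, edist p q ^ (-(3 * κ)) ≤ ENNReal.ofReal |q.x - p.x| ^ (-κ) *
        ENNReal.ofReal |(q.z - p.z + 2 * p.y * q.x) - (2 * p.x) * q.y| ^ (-κ) := by
      intro q
      rw [show 3 * κ = κ + 2 * κ by ring, ENNReal.rpow_neg_add_of_nonneg _ h0 (by positivity)]
      refine mul_le_mul' (edist_rpow_le_x p q h0)
        ((edist_rpow_le_z p q h0).trans_eq ?_)
      congr 3; ring
    refine (setLIntegral_rectangle_le_swap (measurable_edist_rpow_right _ p) h1).trans ?_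
    calc _ ≤ ∫⁻ x in Icc (-r.1) r.1, ENNReal.ofReal |x - p.x| ^ (-κ) *
          (ENNReal.ofReal |0 - 2 * p.x| ^ (-κ) * C * ENNReal.ofReal (2 * r.2 ^ 2)) := by
          refine lintegral_mono fun x => ?_
          rw [← lintegral_const_Icc, ← lintegral_const_mul _ measurable_const]
          refine lintegral_mono fun z => ?_
          refine (lintegral_mono fun y => hsplit ⟨x, y, z⟩).trans ?_
          dsimp only
          rw [lintegral_const_mul _ (by fun_prop), zero_sub, abs_neg]
          gcongr
          exact hlin _ _
      _ ≤ _ := by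
          rw [lintegral_mul_const _ (by fun_prop)]
          gcongr
          exact setLIntegral_Icc_le hC hr1 _
  have hm : Measurable fun p : Heisenberg =>
      C * (ENNReal.ofReal |0 - 2 * p.x| ^ (-κ) * C * ENNReal.ofReal (2 * r.2 ^ 2)) := by
    have := measurable_x
    fun_prop
  calc rectangleEnergy (3 * κ) r ≤ ∫⁻ p in rectangle 1 r,
        C * (ENNReal.ofReal |0 - 2 * p.x| ^ (-κ) * C * ENNReal.ofReal (2 * r.2 ^ 2)) :=
        lintegral_mono hp
    -- The variables without a singularity are `q.z`, `p.z` and `p.y`, which give the factors `2 *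
    -- r.2 ^ 2`, `2 * r.2 ^ 2` and `2 * r.1`.
    _ ≤ ∫⁻ x in Icc (-r.1) r.1, ENNReal.ofReal |0 - 2 * x| ^ (-κ) * (C * (C *
        (ENNReal.ofReal (2 * r.2 ^ 2) * (ENNReal.ofReal (2 * r.2 ^ 2) *
          ENNReal.ofReal (2 * r.1))))) := by
        refine (setLIntegral_rectangle_le hm h1).trans (lintegral_mono fun x => le_of_eq ?_)
        simp only [lintegral_const_Icc]
        ring
    _ ≤ (1 * C) * (C * (C * (ENNReal.ofReal (2 * r.2 ^ 2) * (ENNReal.ofReal (2 * r.2 ^ 2) *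
          ENNReal.ofReal (2 * r.1))))) := by
        rw [lintegral_mul_const _ (by fun_prop)]
        gcongr
        refine (hlin 0 2).trans ?_
        gcongr
        rw [ENNReal.rpow_neg]
        refine ENNReal.inv_le_one.2 ?_
        rw [← ENNReal.one_rpow κ]
        refine ENNReal.rpow_le_rpow ?_ h0
        simp
    _ = _ := by
        rw [← ENNReal.ofReal_mul (by positivity), ← ENNReal.ofReal_mul (by positivity)]
        rw [show 2 * r.2 ^ 2 * (2 * r.2 ^ 2 * (2 * r.1)) = 8 * (r.1 * r.2 ^ 4) by ring]
        ring

/-- Energies are logarithmically convex in the exponent. -/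
theorem rectangleEnergy_interpolate {s₀ s₁ θ : ℝ} (h₀ : 0 ≤ s₀) (h₁ : 0 ≤ s₁) (hθ0 : 0 ≤ θ)
    (hθ1 : θ ≤ 1) :
    rectangleEnergy ((1 - θ) * s₀ + θ * s₁) r ≤
      rectangleEnergy s₀ r ^ (1 - θ) * rectangleEnergy s₁ r ^ θ := by
  have hprod : ∀ s, rectangleEnergy s r = ∫⁻ v : Heisenberg × Heisenberg, edist v.1 v.2 ^ (-s)
      ∂(volume.restrict (rectangle 1 r)).prod (volume.restrict (rectangle 1 r)) := fun s =>
    (lintegral_prod _ (measurable_edist_rpow _).aemeasurable).symm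
  rw [hprod, hprod, hprod]
  refine le_trans (le_of_eq (lintegral_congr fun v => ?_))
    (ENNReal.lintegral_mul_norm_pow_le (measurable_edist_rpow _).aemeasurable
      (measurable_edist_rpow _).aemeasurable (sub_nonneg.2 hθ1) hθ0 (by ring))
  rw [ENNReal.rpow_neg_add_of_nonneg _ (mul_nonneg (sub_nonneg.2 hθ1) h₀) (mul_nonneg hθ0 h₁),
    ← ENNReal.rpow_mul, ← ENNReal.rpow_mul]
  congr 2 <;> ring

end Heisenberg

theorem directedSingularValue_pos (t : ℝ) {r : ℝ × ℝ} (h1 : 0 < r.1) (h2 : 0 < r.2) :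
    0 < directedSingularValue t r := by
  unfold directedSingularValue
  split_ifs <;> positivity

namespace Heisenberg

theorem rectangleEnergy_interpolate_le {r : ℝ × ℝ} {s₀ s₁ θ a₀ a₁ : ℝ} {D : ℝ≥0∞} (h₀ : 0 ≤ s₀)
    (h₁ : 0 ≤ s₁) (hθ0 : 0 ≤ θ) (hθ1 : θ ≤ 1) (ha₀ : 0 < a₀) (ha₁ : 0 < a₁)
    (hE₀ : rectangleEnergy s₀ r ≤ D * ENNReal.ofReal a₀)
    (hE₁ : rectangleEnergy s₁ r ≤ D * ENNReal.ofReal a₁) :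
    rectangleEnergy ((1 - θ) * s₀ + θ * s₁) r ≤ D * ENNReal.ofReal (a₀ ^ (1 - θ) * a₁ ^ θ) := by
  have hθ' : 0 ≤ 1 - θ := sub_nonneg.2 hθ1
  calc _ ≤ rectangleEnergy s₀ r ^ (1 - θ) * rectangleEnergy s₁ r ^ θ :=
        rectangleEnergy_interpolate h₀ h₁ hθ0 hθ1
    _ ≤ (D * ENNReal.ofReal a₀) ^ (1 - θ) * (D * ENNReal.ofReal a₁) ^ θ := by
        gcongr
    _ = D ^ (1 - θ) * D ^ θ * (ENNReal.ofReal a₀ ^ (1 - θ) * ENNReal.ofReal a₁ ^ θ) := by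
        rw [ENNReal.mul_rpow_of_nonneg _ _ hθ', ENNReal.mul_rpow_of_nonneg _ _ hθ0]
        ring
    _ = _ := by
        rw [← ENNReal.rpow_add_of_nonneg _ _ hθ' hθ0, sub_add_cancel, ENNReal.rpow_one,
          ENNReal.ofReal_rpow_of_pos ha₀, ENNReal.ofReal_rpow_of_pos ha₁,
          ← ENNReal.ofReal_mul (by positivity)]

/-- The energy of normalized Lebesgue measure on a rectangle is at most a constant times the
reciprocal of the directed singular value function. -/
theorem exists_rectangleEnergy_le {t κ : ℝ} (ht0 : 0 ≤ t) (ht4 : t ≤ 4) (hκ0 : 0 ≤ κ) (hκ1 : κ < 1)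
    (M : ℝ) : ∃ D : ℝ≥0∞, D ≠ ⊤ ∧ ∀ r : ℝ × ℝ, 0 < r.1 → 0 < r.2 → r.1 ≤ M → r.2 ≤ M →
      rectangleEnergy (κ * t) r ≤
        D * ENNReal.ofReal (r.1 ^ 4 * r.2 ^ 4 / directedSingularValue t r) := by
  -- The interval must contain both kinds of half-sides, `r₁ ≤ M` and `r₂² ≤ M²`.
  obtain ⟨C, hCtop, hC1, hC⟩ := exists_lintegral_abs_sub_rpow_le hκ0 hκ1 (max M (M ^ 2))
  refine ⟨ENNReal.ofReal 64 * C ^ 3,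
    ENNReal.mul_ne_top ENNReal.ofReal_ne_top (ENNReal.pow_ne_top hCtop), ?_⟩
  rintro ⟨a, b⟩ ha hb haM hbM
  dsimp only at ha hb haM hbM ⊢
  set D := ENNReal.ofReal 64 * C ^ 3 with hD
  have hL1 : a ≤ max M (M ^ 2) := haM.trans (le_max_left _ _)
  have hL2 : b ^ 2 ≤ max M (M ^ 2) :=
    (pow_le_pow_left₀ hb.le hbM 2).trans (le_max_right _ _)
  have hconst : ∀ (c A : ℝ) (k : ℕ), c ≤ 64 → 0 < A → k ≤ 3 →
      ENNReal.ofReal (c * A) * C ^ k ≤ D * ENNReal.ofReal A := by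
    intro c A k hc hA hk
    rw [ENNReal.ofReal_mul' hA.le, hD, mul_right_comm]
    gcongr
  have e0 : rectangleEnergy (0 * κ) (a, b) ≤ D * ENNReal.ofReal (a ^ 4 * b ^ 4) := by
    rw [zero_mul]
    refine (rectangleEnergy_zero_le (r := (a, b)) ha.le).trans ?_
    simpa using hconst 64 (a ^ 4 * b ^ 4) 0 le_rfl (by positivity) (by norm_num)
  have e2 : rectangleEnergy (2 * κ) (a, b) ≤ D * ENNReal.ofReal (a ^ 4 * b ^ 2) := by
    refine (rectangleEnergy_two_le (r := (a, b)) ha.le hL2 hκ0 hC).trans ?_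
    simpa using hconst 32 (a ^ 4 * b ^ 2) 1 (by norm_num) (by positivity) (by norm_num)
  have e3 : rectangleEnergy (3 * κ) (a, b) ≤ D * ENNReal.ofReal (a * b ^ 4) :=
    (rectangleEnergy_three_le (r := (a, b)) ha.le hL1 hκ0 hC1 hC).trans
      (hconst 8 (a * b ^ 4) 3 (by norm_num) (by positivity) (by norm_num))
  have e4 : rectangleEnergy (4 * κ) (a, b) ≤ D * ENNReal.ofReal (a ^ 2 * b ^ 2) :=
    (rectangleEnergy_four_le (r := (a, b)) ha.le hL1 hL2 hκ0 hC).trans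
      (hconst 8 (a ^ 2 * b ^ 2) 3 (by norm_num) (by positivity) (by norm_num))
  -- In logarithmic coordinates each identity between products of real powers becomes a linear
  -- identity of exponents.
  obtain ⟨u, rfl⟩ : ∃ u, Real.exp u = a := ⟨Real.log a, Real.exp_log ha⟩
  obtain ⟨v, rfl⟩ : ∃ v, Real.exp v = b := ⟨Real.log b, Real.exp_log hb⟩
  unfold directedSingularValue
  dsimp only
  split_ifs with h12 ht ht
  · convert rectangleEnergy_interpolate_le (θ := t / 2) (by positivity) (by positivity)
      (by positivity) (by linarith) (by positivity) (by positivity) e0 e2 using 3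
    · ring
    · simp only [← Real.exp_mul, ← Real.exp_nat_mul, ← Real.exp_add, ← Real.exp_sub]
      congr 1; push_cast; ring
  · convert rectangleEnergy_interpolate_le (θ := (t - 2) / 2) (by positivity) (by positivity)
      (by linarith) (by linarith) (by positivity) (by positivity) e2 e4 using 3
    · ring
    · simp only [← Real.exp_mul, ← Real.exp_nat_mul, ← Real.exp_add, ← Real.exp_sub]
      congr 1; push_cast; ring
  · convert rectangleEnergy_interpolate_le (θ := t / 3) (by positivity) (by positivity)
      (by positivity) (by linarith) (by positivity) (by positivity) e0 e3 using 3
    · ring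
    · simp only [← Real.exp_mul, ← Real.exp_nat_mul, ← Real.exp_add, ← Real.exp_sub]
      congr 1; push_cast; ring
  · convert rectangleEnergy_interpolate_le (θ := t - 3) (by positivity) (by positivity)
      (by linarith) (by linarith) (by positivity) (by positivity) e3 e4 using 3
    · ring
    · simp only [← Real.exp_mul, ← Real.exp_nat_mul, ← Real.exp_add, ← Real.exp_sub]
      congr 1; push_cast; ring

/-! ### Volumes of rectangles and left invariance -/

instance : LocallyCompactSpace Heisenberg :=
  coordinates.isClosedEmbedding.locallyCompactSpace

theorem volume_box (a b c : ℝ) :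
    volume {h : Heisenberg | |h.x| ≤ a ∧ |h.y| ≤ b ∧ |h.z| ≤ c} =
      ENNReal.ofReal (2 * a) * (ENNReal.ofReal (2 * b) * ENNReal.ofReal (2 * c)) := by
  have h : {h : Heisenberg | |h.x| ≤ a ∧ |h.y| ≤ b ∧ |h.z| ≤ c} =
      coordinates ⁻¹' (Icc (-a) a ×ˢ Icc (-b) b ×ˢ Icc (-c) c) := by
    ext h
    simp only [mem_ofPred_eq, abs_le, mem_preimage, mem_prod, mem_Icc]
    rfl
  rw [volume_apply, h, image_preimage_eq _ coordinates.surjective, Measure.volume_eq_prod,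
    Measure.prod_prod, Measure.volume_eq_prod, Measure.prod_prod, Real.volume_Icc, Real.volume_Icc,
    Real.volume_Icc]
  simp only [sub_neg_eq_add, two_mul]

theorem measurableSet_box (a b c : ℝ) :
    MeasurableSet {h : Heisenberg | |h.x| ≤ a ∧ |h.y| ≤ b ∧ |h.z| ≤ c} :=
  ((isClosed_le continuous_x.abs continuous_const).inter
    ((isClosed_le continuous_y.abs continuous_const).inter
      (isClosed_le continuous_z.abs continuous_const))).measurableSet

theorem volume_le_of_mul_mem {Q S : Set Heisenberg} (hQ : MeasurableSet Q) (hS : MeasurableSet S)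
    (p : Heisenberg) (h : ∀ q ∈ Q, p * q ∈ S) : volume Q ≤ volume S := by
  rw [← lintegral_indicator_one hQ, ← lintegral_indicator_one hS,
    ← lintegral_mul_left (measurable_one.indicator hS) p]
  refine lintegral_mono fun q => ?_
  by_cases hq : q ∈ Q
  · rw [indicator_of_mem hq, indicator_of_mem (h q hq)]; rfl
  · rw [indicator_of_notMem hq]; exact zero_le

/-- Rectangles centred at a point of a compact subset of `W` meet `W` in a fixed proportion. -/
theorem exists_le_volume_rectangle_inter {W B : Set Heisenberg} (hW : IsOpen W) (hB : IsCompact B)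
    (hBW : B ⊆ W) (M : ℝ) : ∃ c : ℝ, 0 < c ∧ ∀ r : ℝ × ℝ, 0 < r.1 → 0 < r.2 → r.1 ≤ M → r.2 ≤ M →
      ∀ x ∈ B, ENNReal.ofReal (c * (r.1 ^ 2 * r.2 ^ 2)) ≤ volume (rectangle x r ∩ W) := by
  obtain ⟨δ, hδ, hδW⟩ := hB.exists_cthickening_subset_open hW hBW
  have hM' : 0 < |M| + 1 := by positivity
  -- A rectangle of radius up to `M` may leave `W`. Shrinking by `θ` keeps it in the
  -- `δ`-neighbourhood of its centre while losing only a fixed proportion of volume.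
  set θ : ℝ := min 1 (δ / (2 * (|M| + 1))) with hθ
  have hθ0 : 0 < θ := lt_min one_pos (by positivity)
  have hθ1 : θ ≤ 1 := min_le_left _ _
  have hθδ : θ * (|M| + 1) ≤ δ / 2 := by
    calc θ * (|M| + 1) ≤ δ / (2 * (|M| + 1)) * (|M| + 1) := by gcongr; exact min_le_right _ _
      _ = δ / 2 := by field_simp
  refine ⟨2 * θ ^ 4, by positivity, fun r h1 h2 hr1 hr2 x hx => ?_⟩
  have hvol : ENNReal.ofReal (2 * θ ^ 4 * (r.1 ^ 2 * r.2 ^ 2)) =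
      volume {h : Heisenberg | |h.x| ≤ θ * r.1 / 2 ∧ |h.y| ≤ θ * r.1 / 2 ∧
        |h.z| ≤ (θ * r.2) ^ 2} := by
    rw [volume_box, ← ENNReal.ofReal_mul (by positivity), ← ENNReal.ofReal_mul (by positivity)]
    congr 1; ring
  rw [hvol]
  refine volume_le_of_mul_mem (measurableSet_box _ _ _)
    ((isClosed_rectangle x r).measurableSet.inter hW.measurableSet) x ?_
  rintro q ⟨hx1, hy1, hz1⟩
  have hab : ∀ a : ℝ, |a| ≤ θ * r.1 / 2 → a ^ 2 ≤ (θ * r.1) ^ 2 / 4 := by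
    intro a ha
    rw [← sq_abs]
    nlinarith [abs_nonneg a]
  have hxy : q.x ^ 2 + q.y ^ 2 ≤ (θ * r.1) ^ 2 := by
    nlinarith [hab _ hx1, hab _ hy1, sq_nonneg (θ * r.1)]
  have hθr : ∀ a : ℝ, 0 < a → a ≤ M → (θ * a) ^ 2 ≤ (δ / 2) ^ 2 ∧ (θ * a) ^ 2 ≤ a ^ 2 := by
    intro a ha haM
    refine ⟨pow_le_pow_left₀ (by positivity) (le_trans ?_ hθδ) 2,
      pow_le_pow_left₀ (by positivity) (by nlinarith) 2⟩
    gcongr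
    linarith [le_abs_self M]
  refine ⟨⟨q, ⟨hxy.trans (hθr _ h1 hr1).2, hz1.trans (hθr _ h2 hr2).2⟩, rfl⟩, hδW ?_⟩
  refine Metric.mem_cthickening_of_dist_le _ x _ _ hx ?_
  rw [dist_comm, dist_def, inv_mul_cancel_left]
  have h4 : q.gauge ^ 4 ≤ δ ^ 4 := by
    rw [gauge_pow_four]
    have hxy' := hxy.trans (hθr _ h1 hr1).1
    have hz' := hz1.trans (hθr _ h2 hr2).1
    have hz2 : q.z ^ 2 ≤ ((δ / 2) ^ 2) ^ 2 := by
      rw [← sq_abs]; exact pow_le_pow_left₀ (abs_nonneg _) hz' 2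
    have hxy2 : (q.x ^ 2 + q.y ^ 2) ^ 2 ≤ ((δ / 2) ^ 2) ^ 2 :=
      pow_le_pow_left₀ (by positivity) hxy' 2
    have : 0 ≤ δ ^ 4 := by positivity
    nlinarith
  exact le_of_pow_le_pow_left₀ (by norm_num) hδ.le h4

theorem edist_mul_left (p q q' : Heisenberg) : edist (p * q) (p * q') = edist q q' := by
  rw [edist_eq, edist_eq]; congr 2; group

theorem setLIntegral_rectangle {f : Heisenberg → ℝ≥0∞} (hf : Measurable f) (p : Heisenberg)
    (r : ℝ × ℝ) : ∫⁻ q in rectangle p r, f q = ∫⁻ q in rectangle 1 r, f (p * q) := by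
  have hmul : Measurable fun q : Heisenberg => p * q := by
    have : Isometry fun q : Heisenberg => p * q := fun q q' => edist_mul_left p q q'
    exact this.continuous.measurable
  rw [← lintegral_indicator (isClosed_rectangle p r).measurableSet,
    ← lintegral_indicator (isClosed_rectangle 1 r).measurableSet,
    ← lintegral_mul_left (hf.indicator (isClosed_rectangle p r).measurableSet) p]
  refine lintegral_congr fun q => ?_
  have : p * q ∈ rectangle p r ↔ q ∈ rectangle 1 r := by
    conv_lhs => rw [← mul_one p, mul_assoc, one_mul, mul_mem_rectangle]
  by_cases hq : q ∈ rectangle 1 r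
  · rw [indicator_of_mem hq, indicator_of_mem (this.2 hq)]
  · rw [indicator_of_notMem hq, indicator_of_notMem fun h => hq (this.1 h)]

/-- Metric and measure are left invariant; the summand `1` of the kernel is the energy of exponent
`0`. -/
theorem lintegral_rectangle_rectangle (s : ℝ) (p : Heisenberg) (r : ℝ × ℝ) :
    ∫⁻ q in rectangle p r, ∫⁻ q' in rectangle p r, (1 + edist q q' ^ (-s)) =
      rectangleEnergy 0 r + rectangleEnergy s r := by
  have hm : ∀ q, Measurable fun q' : Heisenberg => edist q q' ^ (-s) :=
    measurable_edist_rpow_right (-s)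
  have hm2 : Measurable fun v : Heisenberg × Heisenberg => 1 + edist v.1 v.2 ^ (-s) :=
    measurable_const.add (measurable_edist_rpow _)
  have hm3 : Measurable fun q : Heisenberg => ∫⁻ q' in rectangle p r, (1 + edist q q' ^ (-s)) :=
    hm2.lintegral_prod_right'
  rw [setLIntegral_rectangle hm3]
  have h1 : ∀ q, ∫⁻ q' in rectangle p r, (1 + edist (p * q) q' ^ (-s)) =
      (∫⁻ q' in rectangle 1 r, edist q q' ^ (-(0 : ℝ))) +
        ∫⁻ q' in rectangle 1 r, edist q q' ^ (-s) := by
    intro q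
    rw [setLIntegral_rectangle (f := fun q' => 1 + edist (p * q) q' ^ (-s))
      (measurable_const.add (hm _))]
    simp only [edist_mul_left, neg_zero, ENNReal.rpow_zero]
    rw [lintegral_add_left measurable_const]
  simp only [h1]
  rw [lintegral_add_left]
  · rfl
  · exact (measurable_edist_rpow _).lintegral_prod_right'

theorem volume_ne_zero_and_ne_top {W : Set Heisenberg} (hne : W.Nonempty) (hopen : IsOpen W)
    (hbdd : Bornology.IsBounded W) : volume W ≠ 0 ∧ volume W ≠ ⊤ := by
  have h := (isProbabilityMeasure_uniform hne hopen hbdd).measure_univ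
  simp only [uniform, Measure.smul_apply, Measure.restrict_apply_univ, smul_eq_mul] at h
  constructor <;> intro h0 <;> simp [h0] at h

theorem exists_subset_rectangle_one {B : Set Heisenberg} (hB : IsCompact B) :
    ∃ ρ : ℝ, 0 < ρ ∧ B ⊆ rectangle 1 (ρ, ρ) := by
  obtain ⟨R, hR⟩ := hB.isBounded.subset_closedBall 1
  refine ⟨max R 1, by positivity, fun q hq => ?_⟩
  have hd : q.gauge ≤ max R 1 := by
    have := Metric.mem_closedBall'.1 (hR hq)
    rw [dist_def, inv_one, one_mul] at this
    exact this.trans (le_max_left _ _)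
  have h2 : q.gauge ^ 2 ≤ max R 1 ^ 2 := pow_le_pow_left₀ q.gauge_nonneg hd 2
  rw [mem_rectangle, inv_one, one_mul]
  refine ⟨le_trans ?_ h2, q.abs_z_le_gauge_sq.trans h2⟩
  rw [gauge_sq_eq_norm]
  exact (le_abs_self _).trans (Complex.abs_re_le_norm ⟨q.x ^ 2 + q.y ^ 2, q.z⟩)

/-- The function `x ↦ 1_{x ∈ rectangle p r} / ν (rectangle x r)` on `B`, extended by one. -/
noncomputable def hitDensity (ν : Measure Heisenberg) (B : Set Heisenberg) (r : ℝ × ℝ)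
    (p x : Heisenberg) : ℝ≥0∞ :=
  open Classical in
  if x ∈ B then (rectangle p r).indicator 1 x / ν (rectangle x r) else 1

variable {ν : Measure Heisenberg} {B : Set Heisenberg} {r : ℝ × ℝ}

theorem measurable_hitDensity [SFinite ν] (hB : MeasurableSet B) :
    Measurable (Function.uncurry (hitDensity ν B r)) := by
  have hR : MeasurableSet {v : Heisenberg × Heisenberg | v.2 ∈ rectangle v.1 r} :=
    (isClosed_rectangles r).measurableSet
  have h1 : Measurable fun v : Heisenberg × Heisenberg =>
      (rectangle v.1 r).indicator (1 : Heisenberg → ℝ≥0∞) v.2 :=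
    (measurable_one (α := ℝ≥0∞) (β := Heisenberg × Heisenberg)).indicator hR
  have h2 : Measurable fun v : Heisenberg × Heisenberg => ν (rectangle v.2 r) :=
    (measurable_measure_prodMk_left hR).comp measurable_snd
  exact Measurable.ite (measurable_snd hB) (h1.div h2) measurable_const

/-- By symmetry, `x` is hit exactly when the centre falls in the rectangle around `x`. The value one
off `B` makes the mean one at every `x`, as the block argument requires. -/
theorem lintegral_hitDensity [IsProbabilityMeasure ν] (h0 : ∀ x ∈ B, ν (rectangle x r) ≠ 0)
    (x : Heisenberg) :
    ∫⁻ p, hitDensity ν B r p x ∂ν = 1 := by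
  by_cases hx : x ∈ B
  · have hp : ∀ p, hitDensity ν B r p x = (rectangle x r).indicator 1 p / ν (rectangle x r) := by
      intro p
      rw [hitDensity, if_pos hx]
      by_cases h : x ∈ rectangle p r
      · rw [indicator_of_mem h, indicator_of_mem (mem_rectangle_comm.1 h)]; rfl
      · rw [indicator_of_notMem h, indicator_of_notMem fun h' => h (mem_rectangle_comm.2 h')]
    simp only [hp, div_eq_mul_inv]
    have hR := (isClosed_rectangle x r).measurableSet
    rw [lintegral_mul_const _ (measurable_one.indicator hR), lintegral_indicator_one hR,
      ENNReal.mul_inv_cancel (h0 x hx) (measure_ne_top _ _)]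
  · simp [hitDensity, hx]

theorem hitDensity_le {b : ℝ≥0∞} (hb : ∀ x ∈ B, b ≤ ν (rectangle x r)) {p x : Heisenberg}
    (hx : x ∈ B) : hitDensity ν B r p x ≤ b⁻¹ * (rectangle p r).indicator 1 x := by
  rw [hitDensity, if_pos hx, mul_comm, div_eq_mul_inv]
  gcongr
  exact hb x hx

theorem mem_rectangle_of_hitDensity_ne_zero {p x : Heisenberg} (hx : x ∈ B)
    (h : hitDensity ν B r p x ≠ 0) : x ∈ rectangle p r := by
  by_contra hn
  rw [hitDensity, if_pos hx, indicator_of_notMem hn] at h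
  simp at h

theorem lintegral_hitDensity_energy_le (hB : MeasurableSet B) {b : ℝ≥0∞}
    (hb : ∀ x ∈ B, b ≤ ν (rectangle x r)) (s : ℝ) (p : Heisenberg) :
    ∫⁻ x in B, ∫⁻ x' in B, (1 + edist x x' ^ (-s)) *
      (hitDensity ν B r p x * hitDensity ν B r p x') ≤
      b⁻¹ ^ 2 * (rectangleEnergy 0 r + rectangleEnergy s r) := by
  have hR := (isClosed_rectangle p r).measurableSet
  have hm2 : Measurable fun v : Heisenberg × Heisenberg => 1 + edist v.1 v.2 ^ (-s) :=
    measurable_const.add (measurable_edist_rpow _)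
  have hm3 : Measurable fun q : Heisenberg => ∫⁻ q' in rectangle p r, (1 + edist q q' ^ (-s)) :=
    hm2.lintegral_prod_right'
  have hm1 : ∀ x : Heisenberg, Measurable fun x' : Heisenberg => 1 + edist x x' ^ (-s) := fun x =>
    measurable_const.add (measurable_edist_rpow_right _ x)
  rw [← lintegral_rectangle_rectangle s p r]
  calc _ ≤ ∫⁻ x in B, b⁻¹ ^ 2 * (rectangle p r).indicator
        (fun x => ∫⁻ x' in rectangle p r, (1 + edist x x' ^ (-s))) x := by
        refine setLIntegral_mono' hB fun x hx => ?_
        have hpt : ∀ x' ∈ B, (1 + edist x x' ^ (-s)) *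
            (hitDensity ν B r p x * hitDensity ν B r p x') ≤
            b⁻¹ ^ 2 * (rectangle p r).indicator 1 x *
              (rectangle p r).indicator (fun x' => 1 + edist x x' ^ (-s)) x' := by
          intro x' hx'
          calc _ ≤ (1 + edist x x' ^ (-s)) * ((b⁻¹ * (rectangle p r).indicator 1 x) *
                (b⁻¹ * (rectangle p r).indicator 1 x')) := by
                gcongr
                · exact hitDensity_le hb hx
                · exact hitDensity_le hb hx'
            _ = b⁻¹ ^ 2 * (rectangle p r).indicator 1 x *
                ((1 + edist x x' ^ (-s)) * (rectangle p r).indicator 1 x') := by ring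
            _ = _ := by
                congr 1
                by_cases h : x' ∈ rectangle p r
                · rw [indicator_of_mem h, indicator_of_mem h, Pi.one_apply, mul_one]
                · rw [indicator_of_notMem h, indicator_of_notMem h, mul_zero]
        calc _ ≤ ∫⁻ x' in B, b⁻¹ ^ 2 * (rectangle p r).indicator 1 x *
              (rectangle p r).indicator (fun x' => 1 + edist x x' ^ (-s)) x' :=
              setLIntegral_mono' hB hpt
          _ ≤ ∫⁻ x', b⁻¹ ^ 2 * (rectangle p r).indicator 1 x *
              (rectangle p r).indicator (fun x' => 1 + edist x x' ^ (-s)) x' :=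
              setLIntegral_le_lintegral _ _
          _ = b⁻¹ ^ 2 * (rectangle p r).indicator 1 x *
              ∫⁻ x' in rectangle p r, (1 + edist x x' ^ (-s)) := by
              rw [lintegral_const_mul _ ((hm1 x).indicator hR), lintegral_indicator hR]
          _ = _ := by
              by_cases h : x ∈ rectangle p r
              · rw [indicator_of_mem h, indicator_of_mem h, Pi.one_apply, mul_one]
              · rw [indicator_of_notMem h, indicator_of_notMem h, mul_zero, zero_mul]
    _ ≤ ∫⁻ x, b⁻¹ ^ 2 * (rectangle p r).indicator
        (fun x => ∫⁻ x' in rectangle p r, (1 + edist x x' ^ (-s))) x :=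
        setLIntegral_le_lintegral _ _
    _ = _ := by
        rw [lintegral_const_mul _ (hm3.indicator hR), lintegral_indicator hR]

theorem iInter_subset_limsupSet {r : ℕ → ℝ × ℝ} {ω : ℕ → Heisenberg} {N : ℕ → ℕ}
    (hN : StrictMono N) :
    ⋂ i, ⋃ k ∈ Finset.Ico (N i) (N (i + 1)), rectangle (ω k) (r k) ⊆ limsupSet r ω := by
  intro x hx
  rw [limsupSet, Filter.mem_limsup_iff_frequently_mem, frequently_atTop]
  intro n
  obtain ⟨k, hk, hxk⟩ := mem_iUnion₂.1 (mem_iInter.1 hx n)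
  exact ⟨k, (hN.id_le n).trans (Finset.mem_Ico.1 hk).1, hxk⟩

/-- The block product, as a density on `B`, vanishes at any point missed by one of the first `j`
blocks. It thus lives on the compact set `A j`, and the sets `A j` decrease into the limsup set. -/
theorem le_dimH_limsupSet_of_frequently {r : ℕ → ℝ × ℝ} {ω : ℕ → Heisenberg} {N : ℕ → ℕ}
    (hN : StrictMono N) {B : Set Heisenberg} (hB : IsCompact B) {ν : Measure Heisenberg} [SFinite ν]
    {φ : ℕ → ℝ≥0∞} {s : ℝ≥0} (hs : 0 < s) {δ E : ℝ≥0∞} (hδ : δ ≠ 0) (hE : E ≠ ⊤)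
    (h : ∃ᶠ j in atTop,
      δ ≤ ∫⁻ x in B, blockProduct φ (fun n => hitDensity ν B (r n)) N j ω x ∧
      ∫⁻ x in B, ∫⁻ x' in B, (1 + edist x x' ^ (-(s : ℝ))) *
        (blockProduct φ (fun n => hitDensity ν B (r n)) N j ω x *
          blockProduct φ (fun n => hitDensity ν B (r n)) N j ω x') ≤ E) :
    (s : ℝ≥0∞) ≤ dimH (limsupSet r ω) := by
  set A : ℕ → Set Heisenberg := fun j =>
    B ∩ ⋂ i ∈ Finset.range j, ⋃ k ∈ Finset.Ico (N i) (N (i + 1)), rectangle (ω k) (r k) with hA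
  have hclosed : ∀ j, IsClosed (⋂ i ∈ Finset.range j,
      ⋃ k ∈ Finset.Ico (N i) (N (i + 1)), rectangle (ω k) (r k)) := fun j =>
    isClosed_biInter fun i _ => isClosed_biUnion_finset fun k _ => isClosed_rectangle _ _
  have hsub : ⋂ j, A j ⊆ limsupSet r ω := by
    refine subset_trans (fun x hx => mem_iInter.2 fun i => ?_) (iInter_subset_limsupSet hN)
    exact mem_iInter₂.1 (mem_iInter.1 hx (i + 1)).2 i (Finset.self_mem_range_succ i)
  refine le_trans ?_ (dimH_mono hsub)
  refine le_dimH_iInter_of_energy hs (fun i j hij => ?_) (fun j => hB.inter_right (hclosed j)) hδ hE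
    (h.mono ?_)
  · exact inter_subset_inter_right _ (biInter_subset_biInter_left
      fun k hk => Finset.range_subset_range.2 hij hk)
  · rintro j ⟨h1, h2⟩
    set F : Heisenberg → ℝ≥0∞ := blockProduct φ (fun n => hitDensity ν B (r n)) N j ω with hF
    have hFm : Measurable F := (measurable_blockProduct
      (fun n => measurable_hitDensity hB.isClosed.measurableSet) j).comp measurable_prodMk_left
    refine ⟨(volume.restrict B).withDensity F, ?_, ?_, ?_⟩
    · have hAm : MeasurableSet (A j) := (hB.inter_right (hclosed j)).isClosed.measurableSet
      rw [withDensity_apply _ hAm.compl, lintegral_eq_zero_iff hFm,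
        EventuallyEq, ae_restrict_iff' hAm.compl, ae_restrict_iff' hB.isClosed.measurableSet]
      refine Eventually.of_forall fun x hx hxA => ?_
      by_contra hne
      refine hxA ⟨hx, mem_iInter₂.2 fun i hi => ?_⟩
      obtain ⟨k, hk, hg⟩ := exists_mem_block_of_blockProduct_ne_zero hne (Finset.mem_range.1 hi)
      exact mem_iUnion₂.2 ⟨k, hk, mem_rectangle_of_hitDensity_ne_zero hx hg⟩
    · rwa [withDensity_apply _ MeasurableSet.univ, Measure.restrict_univ]
    · have hm1 : Measurable fun x : Heisenberg => ∫⁻ x' in B, F x' * edist x x' ^ (-(s : ℝ)) := by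
        refine Measurable.lintegral_prod_right' (f := fun v : Heisenberg × Heisenberg =>
          F v.2 * edist v.1 v.2 ^ (-(s : ℝ))) ?_
        exact (hFm.comp measurable_snd).mul (measurable_edist_rpow _)
      have h3 : ∀ x, ∫⁻ x', edist x x' ^ (-(s : ℝ)) ∂(volume.restrict B).withDensity F =
          ∫⁻ x' in B, F x' * edist x x' ^ (-(s : ℝ)) := fun x =>
        lintegral_withDensity_eq_lintegral_mul _ hFm (measurable_edist_rpow_right _ x)
      simp only [h3]
      rw [lintegral_withDensity_eq_lintegral_mul _ hFm hm1]
      refine le_trans (lintegral_mono fun x => ?_) h2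
      rw [Pi.mul_apply, ← lintegral_const_mul]
      · refine lintegral_mono fun x' => ?_
        calc F x * (F x' * edist x x' ^ (-(s : ℝ))) = edist x x' ^ (-(s : ℝ)) * (F x * F x') := by
              ring
          _ ≤ _ := by gcongr; exact le_add_self
      · exact hFm.mul (measurable_edist_rpow_right _ x)

/-! ### The almost sure lower bound -/

theorem tsum_ofReal_eq_top {f : ℕ → ℝ} (hf : ∀ n, 0 ≤ f n) (h : ¬ Summable f) :
    ∑' n, ENNReal.ofReal (f n) = ⊤ := by
  by_contra hne
  refine h ((ENNReal.summable_toReal hne).congr fun n => ?_)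
  exact ENNReal.toReal_ofReal (hf n)

theorem ae_le_dimH_limsupSet_mul {W : Set Heisenberg} (hne : W.Nonempty) (hopen : IsOpen W)
    (hbdd : Bornology.IsBounded W) {r : ℕ → ℝ × ℝ} (hpos : ∀ n, 0 < (r n).1 ∧ 0 < (r n).2)
    {M : ℝ} (hM : ∀ n, (r n).1 ≤ M ∧ (r n).2 ≤ M) {t : ℝ} (ht0 : 0 ≤ t) (ht4 : t ≤ 4)
    (hsum : ¬ Summable fun n => directedSingularValue t (r n)) {κ : ℝ} (hκ0 : 0 ≤ κ) (hκ1 : κ < 1) :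
    ∀ᵐ ω ∂uniformSequenceLaw W, ENNReal.ofReal (κ * t) ≤ dimH (limsupSet r ω) := by
  rcases (mul_nonneg hκ0 ht0).eq_or_lt with h0 | hs
  · rw [← h0, ENNReal.ofReal_zero]; exact Eventually.of_forall fun _ => zero_le
  have := isProbabilityMeasure_uniform hne hopen hbdd
  obtain ⟨hW0, hWtop⟩ := volume_ne_zero_and_ne_top hne hopen hbdd
  obtain ⟨x₀, hx₀⟩ := hne
  obtain ⟨B, hB, hxB, hBW⟩ := exists_compact_subset hopen hx₀
  have hBm : MeasurableSet B := hB.isClosed.measurableSet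
  have hB0 : volume B ≠ 0 := by
    refine (lt_of_lt_of_le ?_ (measure_mono interior_subset)).ne'
    rw [volume_apply]
    exact (coordinates.isOpenMap _ isOpen_interior).measure_pos _ ⟨_, mem_image_of_mem _ hxB⟩
  have hBtop : volume B ≠ ⊤ := ((measure_mono hBW).trans_lt hWtop.lt_top).ne
  obtain ⟨c, hc, hvol⟩ := exists_le_volume_rectangle_inter hopen hB hBW M
  set ν := uniform W with hν
  set v : ℕ → ℝ := fun n => (r n).1 ^ 2 * (r n).2 ^ 2 with hv
  have hv0 : ∀ n, 0 < v n := fun n => by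
    have := hpos n
    exact mul_pos (pow_pos this.1 2) (pow_pos this.2 2)
  set b : ℕ → ℝ≥0∞ := fun n => (volume W)⁻¹ * ENNReal.ofReal (c * v n) with hb
  have hbν : ∀ n, ∀ x ∈ B, b n ≤ ν (rectangle x (r n)) := by
    intro n x hx
    rw [hν, uniform, Measure.smul_apply, smul_eq_mul,
      Measure.restrict_apply (isClosed_rectangle _ _).measurableSet]
    exact mul_le_mul_right (hvol (r n) (hpos n).1 (hpos n).2 (hM n).1 (hM n).2 x hx) _
  have hb0 : ∀ n, b n ≠ 0 := fun n =>
    mul_ne_zero (ENNReal.inv_ne_zero.2 hWtop) (ENNReal.ofReal_pos.2 (mul_pos hc (hv0 n))).ne'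
  obtain ⟨D₀, hD₀, hE₀⟩ := exists_rectangleEnergy_le ht0 ht4 le_rfl zero_lt_one M
  obtain ⟨D, hD, hE⟩ := exists_rectangleEnergy_le ht0 ht4 hκ0 hκ1 M
  set φ : ℕ → ℝ≥0∞ := fun n => ENNReal.ofReal (directedSingularValue t (r n)) with hφ
  have hΦ : ∀ n, 0 < directedSingularValue t (r n) := fun n =>
    directedSingularValue_pos t (hpos n).1 (hpos n).2
  -- The squared normalization `(b n)⁻¹ ^ 2` cancels the numerator `v n ^ 2` of the rectangle energy
  -- bounds. `D₀` serves the summand `1` of the kernel and `D` the singular one.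
  set C : ℝ≥0∞ := (volume W) ^ 2 * (ENNReal.ofReal c)⁻¹ ^ 2 * (D₀ + D) with hC
  have hc0 : ENNReal.ofReal c ≠ 0 := (ENNReal.ofReal_pos.2 hc).ne'
  have hCtop : C ≠ ⊤ := ENNReal.mul_ne_top (ENNReal.mul_ne_top (ENNReal.pow_ne_top hWtop)
    (ENNReal.pow_ne_top (ENNReal.inv_ne_top.2 hc0))) (ENNReal.add_ne_top.2 ⟨hD₀, hD⟩)
  have hen : ∀ n p, ∫⁻ x in B, ∫⁻ x' in B, (1 + edist x x' ^ (-(κ * t))) *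
      (hitDensity ν B (r n) p x * hitDensity ν B (r n) p x') ≤ C / φ n := by
    intro n p
    refine (lintegral_hitDensity_energy_le hBm (hbν n) (κ * t) p).trans ?_
    have e0 := hE₀ (r n) (hpos n).1 (hpos n).2 (hM n).1 (hM n).2
    rw [zero_mul] at e0
    have e1 := hE (r n) (hpos n).1 (hpos n).2 (hM n).1 (hM n).2
    refine (mul_le_mul_right (add_le_add e0 e1) _).trans (le_of_eq ?_)
    have hvr : (r n).1 ^ 4 * (r n).2 ^ 4 = v n * v n := by simp only [hv]; ring
    have hv0' : ENNReal.ofReal (v n) ≠ 0 := (ENNReal.ofReal_pos.2 (hv0 n)).ne'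
    have hbinv : (b n)⁻¹ = volume W * ((ENNReal.ofReal c)⁻¹ * (ENNReal.ofReal (v n))⁻¹) := by
      simp only [hb]
      rw [ENNReal.mul_inv (Or.inl (ENNReal.inv_ne_zero.2 hWtop))
          (Or.inl (ENNReal.inv_ne_top.2 hW0)),
        inv_inv, ENNReal.ofReal_mul hc.le,
        ENNReal.mul_inv (Or.inl hc0) (Or.inl ENNReal.ofReal_ne_top)]
    rw [hbinv, hvr, div_eq_mul_inv, ENNReal.ofReal_mul (mul_pos (hv0 n) (hv0 n)).le,
      ENNReal.ofReal_mul (hv0 n).le, ENNReal.ofReal_inv_of_pos (hΦ n), hC, div_eq_mul_inv]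
    have hcancel : (ENNReal.ofReal (v n))⁻¹ * ENNReal.ofReal (v n) = 1 :=
      ENNReal.inv_mul_cancel hv0' ENNReal.ofReal_ne_top
    calc _ = volume W ^ 2 * (ENNReal.ofReal c)⁻¹ ^ 2 * (D₀ + D) * (φ n)⁻¹ *
          ((ENNReal.ofReal (v n))⁻¹ * ENNReal.ofReal (v n)) ^ 2 := by simp only [hφ]; ring
      _ = _ := by rw [hcancel, one_pow, mul_one]
  set s : ℝ≥0 := ⟨κ * t, hs.le⟩ with hsdef
  have hsE : ENNReal.ofReal (κ * t) = (s : ℝ≥0∞) := ENNReal.ofReal_eq_coe_nnreal hs.le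
  have hKm : Measurable fun v : Heisenberg × Heisenberg => 1 + edist v.1 v.2 ^ (-(s : ℝ)) :=
    measurable_const.add (measurable_edist_rpow _)
  have hKfin : ∫⁻ x in B, ∫⁻ x' in B, (1 + edist x x' ^ (-(s : ℝ))) ≠ ⊤ := by
    obtain ⟨ρ, hρ, hBρ⟩ := exists_subset_rectangle_one hB
    obtain ⟨D', hD', hE'⟩ := exists_rectangleEnergy_le ht0 ht4 hκ0 hκ1 ρ
    obtain ⟨D'₀, hD'₀, hE'₀⟩ := exists_rectangleEnergy_le ht0 ht4 le_rfl zero_lt_one ρ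
    have e0 := hE'₀ (ρ, ρ) hρ hρ le_rfl le_rfl
    rw [zero_mul] at e0
    have e1 := hE' (ρ, ρ) hρ hρ le_rfl le_rfl
    refine ne_top_of_le_ne_top ?_ (((lintegral_mono fun x => lintegral_mono_set hBρ).trans
      (lintegral_mono_set hBρ)).trans_eq (lintegral_rectangle_rectangle s 1 (ρ, ρ)))
    exact ENNReal.add_ne_top.2
      ⟨ne_top_of_le_ne_top (ENNReal.mul_ne_top hD'₀ ENNReal.ofReal_ne_top) e0,
      ne_top_of_le_ne_top (ENNReal.mul_ne_top hD' ENNReal.ofReal_ne_top) e1⟩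
  have : IsFiniteMeasure (volume.restrict B) := ⟨by
    rw [Measure.restrict_apply_univ]; exact hBtop.lt_top⟩
  rw [hsE, ae_iff]
  -- The blocks depend on `η` but the exceptional event does not, so its probability is at most
  -- every `η > 0`.
  refine le_antisymm (le_of_forall_pos_le_add fun η hη => ?_) zero_le
  obtain ⟨N, δ, E, hN, hδ, hEtop, hP⟩ := exists_blockProduct_frequently (φ := φ)
    (g := fun n => hitDensity ν B (r n)) ν (volume.restrict B)
    (by rwa [Measure.restrict_apply_univ]) (fun n => (ENNReal.ofReal_pos.2 (hΦ n)).ne')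
    (fun n => ENNReal.ofReal_ne_top) (tsum_ofReal_eq_top (fun n => (hΦ n).le) hsum)
    (fun n => measurable_hitDensity hBm)
    (fun n => lintegral_hitDensity fun x hx =>
      ((pos_iff_ne_zero.2 (hb0 n)).trans_le (hbν n x hx)).ne')
    (fun n => by
      refine ⟨((b n)⁻¹ + 1).toNNReal, fun p x => ?_⟩
      rw [ENNReal.coe_toNNReal (ENNReal.add_ne_top.2
        ⟨ENNReal.inv_ne_top.2 (hb0 n), ENNReal.one_ne_top⟩)]
      by_cases hx : x ∈ B
      · refine (hitDensity_le (hbν n) hx).trans (le_trans ?_ le_self_add)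
        refine mul_le_of_le_one_right' ?_
        exact indicator_apply_le' (fun _ => le_rfl) fun _ => zero_le
      · rw [hitDensity, if_neg hx]; exact le_add_self)
    (K := fun x x' => 1 + edist x x' ^ (-(s : ℝ))) hKm (fun _ _ => le_self_add) hKfin hCtop
    (fun n => (lintegral_mono fun p => hen n p).trans_eq (by simp)) hη.ne'
  rw [zero_add]
  refine (measure_mono fun ω hω => ?_).trans hP
  exact fun hfreq => hω (le_dimH_limsupSet_of_frequently hN hB hs hδ hEtop hfreq)

theorem ae_le_dimH_limsupSet {W : Set Heisenberg} (hne : W.Nonempty) (hopen : IsOpen W)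
    (hbdd : Bornology.IsBounded W) {r : ℕ → ℝ × ℝ} (hpos : ∀ n, 0 < (r n).1 ∧ 0 < (r n).2)
    {M : ℝ} (hM : ∀ n, (r n).1 ≤ M ∧ (r n).2 ≤ M) {t : ℝ} (ht0 : 0 ≤ t) (ht4 : t ≤ 4)
    (hsum : ¬ Summable fun n => directedSingularValue t (r n)) :
    ∀ᵐ ω ∂uniformSequenceLaw W, ENNReal.ofReal t ≤ dimH (limsupSet r ω) := by
  obtain ⟨κ, -, hκ, hlim⟩ := exists_seq_strictMono_tendsto' (zero_lt_one (α := ℝ))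
  have hall : ∀ᵐ ω ∂uniformSequenceLaw W, ∀ n, ENNReal.ofReal (κ n * t) ≤ dimH (limsupSet r ω) :=
    ae_all_iff.2 fun n =>
      ae_le_dimH_limsupSet_mul hne hopen hbdd hpos hM ht0 ht4 hsum (hκ n).1.le (hκ n).2
  filter_upwards [hall] with ω hω
  have h : Tendsto (fun n => ENNReal.ofReal (κ n * t)) atTop (𝓝 (ENNReal.ofReal (1 * t))) :=
    ENNReal.tendsto_ofReal (hlim.mul_const t)
  rw [one_mul] at h
  exact le_of_tendsto' h hω

end Heisenberg

/-! ### Coverings and the upper bound -/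

theorem dimH_le_of_forall_exists_cover {X : Type*} [MetricSpace X] [MeasurableSpace X]
    [BorelSpace X] {A : Set X} {t : ℝ} (ht : 0 ≤ t) {C : ℝ≥0∞} (hC : C ≠ ⊤)
    (h : ∀ ε : ℝ≥0∞, ε ≠ 0 → ∃ (ι : Type) (_ : Countable ι) (c : ι → X) (ρ : ι → ℝ),
      A ⊆ ⋃ i, Metric.closedBall (c i) (ρ i) ∧ (∀ i, ENNReal.ofReal (ρ i) ≤ ε) ∧
      ∑' i, ENNReal.ofReal (ρ i) ^ t ≤ C) :
    dimH A ≤ ENNReal.ofReal t := by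
  have h' : ∀ n : ℕ, ∃ (ι : Type) (_ : Countable ι) (c : ι → X) (ρ : ι → ℝ),
      A ⊆ ⋃ i, Metric.closedBall (c i) (ρ i) ∧ (∀ i, ENNReal.ofReal (ρ i) ≤ (n : ℝ≥0∞)⁻¹) ∧
      ∑' i, ENNReal.ofReal (ρ i) ^ t ≤ C := fun n =>
    h _ (ENNReal.inv_ne_zero.2 (ENNReal.natCast_ne_top n))
  choose ι hι c ρ hcov hρ hsum using h'
  have hdiam : ∀ n i, Metric.ediam (Metric.closedBall (c n i) (ρ n i)) ≤
      2 * ENNReal.ofReal (ρ n i) := by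
    intro n i
    refine Metric.ediam_le fun x hx y hy => ?_
    rw [two_mul]
    refine (edist_triangle_right x y (c n i)).trans (add_le_add ?_ ?_) <;>
    · rw [edist_dist]; exact ENNReal.ofReal_le_ofReal (by assumption)
  have hμ : Measure.hausdorffMeasure t A ≤ 2 ^ t * C := by
    refine (Measure.hausdorffMeasure_le_liminf_tsum t A (l := atTop)
      (fun n : ℕ => 2 * (n : ℝ≥0∞)⁻¹) ?_
      (fun n i => Metric.closedBall (c n i) (ρ n i))
      (Eventually.of_forall fun n i => (hdiam n i).trans (by gcongr; exact hρ n i))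
      (Eventually.of_forall hcov)).trans ?_
    · have := ENNReal.Tendsto.const_mul (a := 2) ENNReal.tendsto_inv_nat_nhds_zero
        (Or.inr ENNReal.ofNat_ne_top)
      rwa [mul_zero] at this
    · refine liminf_le_of_le (by isBoundedDefault) fun b hb => ?_
      obtain ⟨n, hn⟩ := hb.exists
      refine hn.trans ?_
      calc _ ≤ ∑' i, 2 ^ t * ENNReal.ofReal (ρ n i) ^ t := by
            refine ENNReal.tsum_le_tsum fun i => ?_
            rw [← ENNReal.mul_rpow_of_nonneg _ _ ht]
            exact ENNReal.rpow_le_rpow (hdiam n i) ht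
        _ ≤ _ := by rw [ENNReal.tsum_mul_left]; gcongr; exact hsum n
  have hne : Measure.hausdorffMeasure ((⟨t, ht⟩ : ℝ≥0) : ℝ) A ≠ ⊤ :=
    ne_top_of_le_ne_top (ENNReal.mul_ne_top
      (ENNReal.rpow_ne_top_of_nonneg ht ENNReal.ofNat_ne_top) hC) hμ
  rw [ENNReal.ofReal_eq_coe_nnreal ht]
  exact dimH_le_of_hausdorffMeasure_ne_top hne

namespace Heisenberg

theorem abs_floor_le {x y : ℝ} (h : |x| ≤ y) : ⌊x⌋ ∈ Finset.Icc (-(⌊y⌋ + 1)) (⌊y⌋ + 1) := by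
  obtain ⟨h1, h2⟩ := abs_le.1 h
  rw [Finset.mem_Icc]
  constructor
  · rw [Int.le_floor]
    push_cast
    linarith [Int.lt_floor_add_one y]
  · exact (Int.floor_le_floor h2).trans (by linarith)

theorem card_Icc_floor_le {y : ℝ} (hy : 1 ≤ y) :
    ((Finset.Icc (-(⌊y⌋ + 1)) (⌊y⌋ + 1)).card : ℝ) ≤ 5 * y := by
  have h0 : 0 ≤ ⌊y⌋ := Int.floor_nonneg.2 (by linarith)
  rw [Int.card_Icc]
  have : (((⌊y⌋ + 1 + 1 - -(⌊y⌋ + 1)).toNat : ℤ) : ℝ) = 2 * ⌊y⌋ + 3 := by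
    rw [Int.toNat_of_nonneg (by linarith)]; push_cast; ring
  rw [Int.cast_natCast] at this
  rw [this]
  linarith [Int.floor_le y]

theorem floor_mul_sub_mem {x δ : ℝ} (hδ : 0 < δ) :
    0 ≤ x - ⌊x / δ⌋ * δ ∧ x - ⌊x / δ⌋ * δ ≤ δ := by
  have h1 := (le_div_iff₀ hδ).1 (Int.floor_le (x / δ))
  have h2 := (div_lt_iff₀ hδ).1 (Int.lt_floor_add_one (x / δ))
  constructor <;> nlinarith

theorem gauge_le_two_mul {h : Heisenberg} {δ : ℝ} (hδ : 0 ≤ δ) (hx : |h.x| ≤ δ) (hy : |h.y| ≤ δ)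
    (hz : |h.z| ≤ δ ^ 2) : h.gauge ≤ 2 * δ := by
  refine le_of_pow_le_pow_left₀ (n := 4) (by norm_num) (by positivity) ?_
  rw [gauge_pow_four]
  have h1 : h.x ^ 2 ≤ δ ^ 2 := sq_le_sq' (abs_le.1 hx).1 (abs_le.1 hx).2
  have h2 : h.y ^ 2 ≤ δ ^ 2 := sq_le_sq' (abs_le.1 hy).1 (abs_le.1 hy).2
  have h3 : h.z ^ 2 ≤ (δ ^ 2) ^ 2 := sq_le_sq' (abs_le.1 hz).1 (abs_le.1 hz).2
  have h4 : (h.x ^ 2 + h.y ^ 2) ^ 2 ≤ (2 * δ ^ 2) ^ 2 :=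
    pow_le_pow_left₀ (by positivity) (by linarith) 2
  have : 0 ≤ δ ^ 4 := by positivity
  nlinarith

/-- A rectangle is covered by as many balls of a suitable radius `δ` as comparison of volumes
predicts. -/
theorem exists_cover_rectangle_one {r : ℝ × ℝ} {δ : ℝ} (hδ : 0 < δ) (h1 : δ ≤ r.1)
    (h2 : δ * r.1 ≤ r.2 ^ 2) : ∃ S : Finset Heisenberg,
      (S.card : ℝ) ≤ 1125 * (r.1 ^ 2 * r.2 ^ 2 / δ ^ 4) ∧
      rectangle 1 r ⊆ ⋃ g ∈ S, Metric.closedBall g (2 * δ) := by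
  classical
  have hr1 : 0 < r.1 := hδ.trans_le h1
  set I := Finset.Icc (-(⌊r.1 / δ⌋ + 1)) (⌊r.1 / δ⌋ + 1) with hI
  -- The vertical offset is at most `r₂² + 4 * δ * r₁ ≤ 5 * r₂²`, so `9` is ample; `1125 = 5 ^ 3 *
  -- 9`, one factor `5` per index range.
  set J := Finset.Icc (-(⌊9 * r.2 ^ 2 / δ ^ 2⌋ + 1)) (⌊9 * r.2 ^ 2 / δ ^ 2⌋ + 1) with hJ
  have hδ2 : δ ^ 2 ≤ r.2 ^ 2 := by nlinarith
  refine ⟨(I ×ˢ I ×ˢ J).image fun i => ⟨i.1 * δ, i.2.1 * δ, i.2.2 * δ ^ 2⟩, ?_, fun q hq => ?_⟩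
  · have hIc : (I.card : ℝ) ≤ 5 * (r.1 / δ) :=
      card_Icc_floor_le ((one_le_div hδ).2 h1)
    have hJc : (J.card : ℝ) ≤ 5 * (9 * r.2 ^ 2 / δ ^ 2) :=
      card_Icc_floor_le ((one_le_div (by positivity)).2 (by nlinarith))
    calc _ ≤ ((I ×ˢ I ×ˢ J).card : ℝ) := by exact_mod_cast Finset.card_image_le
      _ = I.card * (I.card * J.card) := by
          rw [Finset.card_product, Finset.card_product]; push_cast; ring
      _ ≤ 5 * (r.1 / δ) * (5 * (r.1 / δ) * (5 * (9 * r.2 ^ 2 / δ ^ 2))) := by gcongr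
      _ = _ := by field_simp; norm_num; ring
  · obtain ⟨hx, hy, hz⟩ := box_of_mem_rectangle_one hr1.le hq
    have hx' := abs_le.2 hx
    have hy' := abs_le.2 hy
    have hz' := abs_le.2 hz
    set i := ⌊q.x / δ⌋ with hi
    set j := ⌊q.y / δ⌋ with hj
    obtain ⟨hα0, hα1⟩ := floor_mul_sub_mem (x := q.x) hδ
    obtain ⟨hβ0, hβ1⟩ := floor_mul_sub_mem (x := q.y) hδ
    set α := q.x - i * δ with hα
    set β := q.y - j * δ with hβ
    -- This is the vertical coordinate of `q` seen from `(i * δ, j * δ, 0)`. Rounding it, rather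
    -- than `q.z`, makes the grid follow the group law.
    set w := q.z - 2 * (i * δ * q.y - j * δ * q.x) with hw
    have hwr : |w| ≤ 9 * r.2 ^ 2 := by
      have e : w = q.z - 2 * (q.x * β - q.y * α) := by rw [hw, hα, hβ]; ring
      have b1 : |q.x * β| ≤ r.1 * δ := by
        rw [abs_mul, abs_of_nonneg hβ0]; exact mul_le_mul hx' hβ1 hβ0 hr1.le
      have b2 : |q.y * α| ≤ r.1 * δ := by
        rw [abs_mul, abs_of_nonneg hα0]; exact mul_le_mul hy' hα1 hα0 hr1.le
      rw [e]
      obtain ⟨b11, b12⟩ := abs_le.1 b1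
      obtain ⟨b21, b22⟩ := abs_le.1 b2
      obtain ⟨hz1, hz2⟩ := abs_le.1 hz'
      rw [abs_le]
      constructor <;> nlinarith
    set l := ⌊w / δ ^ 2⌋ with hl
    obtain ⟨hγ0, hγ1⟩ := floor_mul_sub_mem (x := w) (δ := δ ^ 2) (by positivity)
    refine mem_iUnion₂.2 ⟨⟨i * δ, j * δ, l * δ ^ 2⟩, Finset.mem_image.2 ⟨(i, j, l), ?_, rfl⟩, ?_⟩
    · have hd : ∀ a : ℝ, |a| ≤ r.1 → |a / δ| ≤ r.1 / δ := by
        intro a ha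
        rw [abs_div, abs_of_pos hδ]; gcongr
      refine Finset.mem_product.2 ⟨abs_floor_le (hd _ hx'),
        Finset.mem_product.2 ⟨abs_floor_le (hd _ hy'), abs_floor_le ?_⟩⟩
      rw [abs_div, abs_of_pos (by positivity : 0 < δ ^ 2)]; gcongr
    · rw [Metric.mem_closedBall', dist_def]
      refine gauge_le_two_mul hδ.le ?_ ?_ ?_
      · simp only [mul_x, inv_x]
        rw [abs_le]; constructor <;> linarith
      · simp only [mul_y, inv_y]
        rw [abs_le]; constructor <;> linarith
      · simp only [mul_z, inv_x, inv_y, inv_z]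
        rw [abs_le]; constructor <;> nlinarith

theorem exists_cover_rectangle {r : ℝ × ℝ} {ρ : ℝ} {n : ℝ}
    (h : ∃ S : Finset Heisenberg, (S.card : ℝ) ≤ n ∧
      rectangle 1 r ⊆ ⋃ g ∈ S, Metric.closedBall g ρ) (p : Heisenberg) :
    ∃ S : Finset Heisenberg, (S.card : ℝ) ≤ n ∧
      rectangle p r ⊆ ⋃ g ∈ S, Metric.closedBall g ρ := by
  classical
  obtain ⟨S, hcard, hS⟩ := h
  refine ⟨S.image fun g => p * g, le_trans (by exact_mod_cast Finset.card_image_le) hcard, ?_⟩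
  intro q hq
  have hq1 : p⁻¹ * q ∈ rectangle 1 r := by
    rw [mem_rectangle] at hq ⊢; simpa using hq
  obtain ⟨g, hg, hd⟩ := mem_iUnion₂.1 (hS hq1)
  refine mem_iUnion₂.2 ⟨p * g, Finset.mem_image_of_mem _ hg, ?_⟩
  rw [Metric.mem_closedBall, dist_def] at hd ⊢
  convert hd using 2
  group

theorem rectangle_one_subset_closedBall {r : ℝ × ℝ} {a : ℝ} (h1 : 0 ≤ r.1) (ha : r.1 ≤ a)
    (h2 : 0 ≤ r.2) (hb : r.2 ≤ a) : rectangle 1 r ⊆ Metric.closedBall 1 (2 * a) := by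
  intro q hq
  obtain ⟨hx, hy, hz⟩ := box_of_mem_rectangle_one h1 hq
  rw [Metric.mem_closedBall', dist_def, inv_one, one_mul]
  exact gauge_le_two_mul (h1.trans ha) ((abs_le.2 hx).trans ha) ((abs_le.2 hy).trans ha)
    ((abs_le.2 hz).trans (pow_le_pow_left₀ h2 hb 2))

/-- Optimal coverings of rectangles in terms of the directed singular value function. -/
theorem exists_cover_directedSingularValue {t : ℝ} (ht4 : t ≤ 4) {r : ℝ × ℝ}
    (h1 : 0 < r.1) (h2 : 0 < r.2) : ∃ ρ n : ℝ, 0 < ρ ∧ 1 ≤ n ∧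
      n * ρ ^ t ≤ 18000 * directedSingularValue t r ∧
      ∀ p, ∃ S : Finset Heisenberg, (S.card : ℝ) ≤ n ∧
        rectangle p r ⊆ ⋃ g ∈ S, Metric.closedBall g ρ := by
  -- The balls have radius twice the scale, which costs `2 ^ t ≤ 16`; `18000 = 16 * 1125`.
  have h16 : (2 : ℝ) ^ t ≤ 16 := by
    calc (2 : ℝ) ^ t ≤ 2 ^ (4 : ℝ) := Real.rpow_le_rpow_of_exponent_le one_le_two ht4
      _ = 16 := by norm_num
  have hball : ∀ a : ℝ, 0 < a → r.1 ≤ a → r.2 ≤ a → ∀ p, ∃ S : Finset Heisenberg,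
      (S.card : ℝ) ≤ 1 ∧ rectangle p r ⊆ ⋃ g ∈ S, Metric.closedBall g (2 * a) := by
    intro a ha ha1 ha2
    refine exists_cover_rectangle ⟨{1}, by simp, ?_⟩
    simpa using rectangle_one_subset_closedBall h1.le ha1 h2.le ha2
  have hcost : ∀ a : ℝ, 0 < a → 1 * (2 * a) ^ t ≤ 18000 * a ^ t := by
    intro a ha
    rw [one_mul, Real.mul_rpow zero_le_two ha.le]
    gcongr
    linarith
  have hgrid : ∀ δ : ℝ, 0 < δ → 1125 * (r.1 ^ 2 * r.2 ^ 2 / δ ^ 4) * (2 * δ) ^ t ≤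
      18000 * (r.1 ^ 2 * r.2 ^ 2 / δ ^ 4 * δ ^ t) := by
    intro δ hδ
    rw [Real.mul_rpow zero_le_two hδ.le]
    have : 0 ≤ r.1 ^ 2 * r.2 ^ 2 / δ ^ 4 * δ ^ t := by positivity
    nlinarith
  have hone : ∀ δ : ℝ, 0 < δ → δ ≤ r.1 → δ * r.1 ≤ r.2 ^ 2 →
      1 ≤ 1125 * (r.1 ^ 2 * r.2 ^ 2 / δ ^ 4) := by
    intro δ hδ hd1 hd2
    have : 1 ≤ r.1 ^ 2 * r.2 ^ 2 / δ ^ 4 := by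
      rw [one_le_div (by positivity)]
      calc δ ^ 4 = δ ^ 2 * δ ^ 2 := by ring
        _ ≤ r.1 ^ 2 * r.2 ^ 2 := by
            gcongr ?_ * ?_
            · exact pow_le_pow_left₀ hδ.le hd1 2
            · nlinarith
    linarith
  obtain ⟨a, b⟩ := r
  dsimp only at *
  unfold directedSingularValue
  dsimp only
  split_ifs with h12 ht ht
  · exact ⟨2 * b, 1, by positivity, le_rfl, hcost b h2, hball b h2 h12 le_rfl⟩
  -- Tall rectangle: the grid at scale `a` stacks balls vertically, about `b ^ 2 / a ^ 2` of them.
  · have hd : a * a ≤ b ^ 2 := by nlinarith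
    refine ⟨2 * a, _, by positivity, hone a h1 le_rfl hd, (hgrid a h1).trans (le_of_eq ?_),
      exists_cover_rectangle (exists_cover_rectangle_one (r := (a, b)) h1 le_rfl hd)⟩
    obtain ⟨u, rfl⟩ : ∃ u, Real.exp u = a := ⟨Real.log a, Real.exp_log h1⟩
    obtain ⟨v, rfl⟩ : ∃ v, Real.exp v = b := ⟨Real.log b, Real.exp_log h2⟩
    simp only [← Real.exp_mul, ← Real.exp_nat_mul, ← Real.exp_add, ← Real.exp_sub]
    congr 2; push_cast; ring
  · exact ⟨2 * a, 1, by positivity, le_rfl, hcost a h1, hball a h1 le_rfl (not_le.1 h12).le⟩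
  -- Flat rectangle: at scale `δ = b ^ 2 / a` the twist `δ * a` across the rectangle equals its
  -- height parameter `b ^ 2`, so this is the largest scale that the grid covering admits.
  · have hδ : 0 < b ^ 2 / a := by positivity
    have hd1 : b ^ 2 / a ≤ a := by
      rw [div_le_iff₀ h1]; nlinarith [not_le.1 h12]
    have hd2 : b ^ 2 / a * a ≤ b ^ 2 := (div_mul_cancel₀ _ h1.ne').le
    refine ⟨2 * (b ^ 2 / a), _, by positivity, hone _ hδ hd1 hd2, (hgrid _ hδ).trans (le_of_eq ?_),
      exists_cover_rectangle (exists_cover_rectangle_one (r := (a, b)) hδ hd1 hd2)⟩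
    obtain ⟨u, rfl⟩ : ∃ u, Real.exp u = a := ⟨Real.log a, Real.exp_log h1⟩
    obtain ⟨v, rfl⟩ : ∃ v, Real.exp v = b := ⟨Real.log b, Real.exp_log h2⟩
    simp only [← Real.exp_mul, ← Real.exp_nat_mul, ← Real.exp_add, ← Real.exp_sub]
    congr 2; push_cast; ring

/-- The limsup set is covered by the rectangles beyond any index, each replaced by its optimal
balls. The total cost is bounded by the convergent series, whatever the centres are. -/
theorem dimH_limsupSet_le {t : ℝ} (ht0 : 0 ≤ t) (ht4 : t ≤ 4) {r : ℕ → ℝ × ℝ}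
    (hpos : ∀ n, 0 < (r n).1 ∧ 0 < (r n).2)
    (hsum : Summable fun n => directedSingularValue t (r n)) (ω : ℕ → Heisenberg) :
    dimH (limsupSet r ω) ≤ ENNReal.ofReal t := by
  -- At `t = 0` every term of the series is `1`, which contradicts summability.
  have htpos : 0 < t := by
    rcases ht0.eq_or_lt with rfl | h
    · have h1 : ∀ n, directedSingularValue 0 (r n) = 1 := by
        intro n
        unfold directedSingularValue
        split_ifs <;> first | exact Real.rpow_zero _ | linarith
      simp [h1, summable_const_iff] at hsum
    · exact h
  have hΦ : ∀ n, 0 < directedSingularValue t (r n) := fun n =>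
    directedSingularValue_pos t (hpos n).1 (hpos n).2
  choose ρ m hρ hm hcost hcov using fun n =>
    exists_cover_directedSingularValue ht4 (hpos n).1 (hpos n).2
  choose S hcard hS using fun n => hcov n (ω n)
  set φ : ℕ → ℝ≥0∞ := fun n => ENNReal.ofReal (18000 * directedSingularValue t (r n)) with hφ
  have hφsum : ∑' n, φ n ≠ ⊤ := (hsum.mul_left 18000).tsum_ofReal_ne_top
  -- Since `m n ≥ 1`, a single ball costs no more than the whole cover; small tails therefore force
  -- small radii.
  have hρφ : ∀ n, ENNReal.ofReal (ρ n) ^ t ≤ φ n := by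
    intro n
    rw [ENNReal.ofReal_rpow_of_pos (hρ n)]
    refine ENNReal.ofReal_le_ofReal (le_trans ?_ (hcost n))
    exact le_mul_of_one_le_left (Real.rpow_nonneg (hρ n).le _) (hm n)
  refine dimH_le_of_forall_exists_cover ht0 hφsum fun ε hε => ?_
  have hεt : (0 : ℝ≥0∞) < ε ^ t := by
    rw [pos_iff_ne_zero, Ne, ENNReal.rpow_eq_zero_iff]
    rintro (⟨h, -⟩ | ⟨-, h⟩)
    · exact hε h
    · linarith
  obtain ⟨N, hN⟩ := ((tendsto_order.1 (ENNReal.tendsto_sum_nat_add φ hφsum)).2 _ hεt).exists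
  refine ⟨Σ n : ℕ, {g // g ∈ S (n + N)}, inferInstance, fun i => i.2.1, fun i => ρ (i.1 + N),
    fun x hx => ?_, fun i => ?_, ?_⟩
  · rw [limsupSet, Filter.mem_limsup_iff_frequently_mem, frequently_atTop] at hx
    obtain ⟨k, hk, hxk⟩ := hx N
    obtain ⟨n, rfl⟩ := Nat.exists_eq_add_of_le' hk
    obtain ⟨g, hg, hxg⟩ := mem_iUnion₂.1 (hS _ hxk)
    exact mem_iUnion.2 ⟨⟨n, g, hg⟩, hxg⟩
  · rw [← ENNReal.rpow_le_rpow_iff htpos]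
    exact (hρφ _).trans ((ENNReal.le_tsum (f := fun k => φ (k + N)) i.1).trans hN.le)
  · rw [ENNReal.tsum_sigma']
    calc _ ≤ ∑' n, φ (n + N) := by
          refine ENNReal.tsum_le_tsum fun n => ?_
          dsimp only
          rw [tsum_fintype, Finset.sum_const, Finset.card_univ, Fintype.card_coe, nsmul_eq_mul,
            ENNReal.ofReal_rpow_of_pos (hρ _), ← ENNReal.ofReal_natCast,
            ← ENNReal.ofReal_mul (Nat.cast_nonneg _)]
          refine ENNReal.ofReal_le_ofReal (le_trans ?_ (hcost (n + N)))
          exact mul_le_mul_of_nonneg_right (hcard _) (Real.rpow_nonneg (hρ _).le _)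
      _ ≤ ∑' n, φ n := ENNReal.tsum_comp_le_tsum_of_injective (add_left_injective N) φ

/-- A bounded rectangle needs on the order of `δ⁻⁴` balls of radius `δ`, and countably many
rectangles exhaust the group. -/
theorem dimH_le_four (A : Set Heisenberg) : dimH A ≤ 4 := by
  have hcov : A ⊆ ⋃ m : ℕ, rectangle 1 ((m : ℝ) + 1, (m : ℝ) + 1) := by
    intro q _
    obtain ⟨m, hm⟩ := exists_nat_ge q.gauge
    refine mem_iUnion.2 ⟨m, ?_⟩
    have h2 : q.gauge ^ 2 ≤ ((m : ℝ) + 1) ^ 2 :=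
      pow_le_pow_left₀ q.gauge_nonneg (hm.trans (by linarith)) 2
    rw [mem_rectangle, inv_one, one_mul]
    refine ⟨le_trans ?_ h2, q.abs_z_le_gauge_sq.trans h2⟩
    rw [gauge_sq_eq_norm]
    exact (le_abs_self _).trans (Complex.abs_re_le_norm ⟨q.x ^ 2 + q.y ^ 2, q.z⟩)
  refine (dimH_mono hcov).trans ?_
  rw [dimH_iUnion]
  refine iSup_le fun m => ?_
  rw [← ENNReal.ofReal_ofNat]
  set a : ℝ := m + 1 with ha
  have ha1 : 1 ≤ a := by simp [ha]
  refine dimH_le_of_forall_exists_cover (C := ENNReal.ofReal (18000 * a ^ 4)) (by norm_num)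
    ENNReal.ofReal_ne_top fun ε hε => ?_
  obtain ⟨δ, hδ0, hδε⟩ : ∃ δ : ℝ≥0, 0 < δ ∧ (δ : ℝ≥0∞) < min ε 1 :=
    ENNReal.lt_iff_exists_nnreal_btwn.1 (lt_min (pos_iff_ne_zero.2 hε) one_pos) |>.imp
      fun δ h => ⟨ENNReal.coe_pos.1 h.1, h.2⟩
  have hδ1 : (δ : ℝ) ≤ 1 := by exact_mod_cast (hδε.trans_le (min_le_right _ _)).le
  have hδ : (0 : ℝ) < δ / 2 := by positivity
  obtain ⟨S, hcard, hS⟩ := exists_cover_rectangle_one (r := (a, a)) hδ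
    (show (δ : ℝ) / 2 ≤ a by linarith) (show (δ : ℝ) / 2 * a ≤ a ^ 2 by nlinarith)
  refine ⟨Fin S.card, inferInstance, fun i => (S.equivFin.symm i).1, fun _ => δ, fun x hx => ?_,
    fun _ => ?_, ?_⟩
  · obtain ⟨g, hg, hxg⟩ := mem_iUnion₂.1 (hS hx)
    refine mem_iUnion.2 ⟨S.equivFin ⟨g, hg⟩, ?_⟩
    rw [mul_div_cancel₀ _ two_ne_zero] at hxg
    simpa using hxg
  · rw [ENNReal.ofReal_coe_nnreal]; exact (hδε.trans_le (min_le_left _ _)).le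
  · rw [tsum_fintype, Finset.sum_const, Finset.card_univ, Fintype.card_fin, nsmul_eq_mul,
      ENNReal.ofReal_rpow_of_pos (by positivity), ← ENNReal.ofReal_natCast,
      ← ENNReal.ofReal_mul (Nat.cast_nonneg _)]
    refine ENNReal.ofReal_le_ofReal ?_
    calc (S.card : ℝ) * (δ : ℝ) ^ (4 : ℝ)
        ≤ 1125 * (a ^ 2 * a ^ 2 / ((δ : ℝ) / 2) ^ 4) * (δ : ℝ) ^ (4 : ℝ) := by gcongr
      _ = 18000 * a ^ 4 := by
          rw [show (4 : ℝ) = ((4 : ℕ) : ℝ) by norm_num, Real.rpow_natCast]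
          field_simp; norm_num

end Heisenberg

end

/-! ### Combining the two bounds -/

theorem theorem1p1 (W : Set Heisenberg) (hne : W.Nonempty) (hopen : IsOpen W)
    (hbdd : Bornology.IsBounded W)
    (r : ℕ → ℝ × ℝ) (hpos : ∀ n, 0 < (r n).1 ∧ 0 < (r n).2)
    (hr : Bornology.IsBounded (Set.range r)) :
    ∀ᵐ ω ∂(Heisenberg.uniformSequenceLaw W),
      dimH (Heisenberg.limsupSet r ω) =
        min (sInf (ENNReal.ofReal ''
          {t : ℝ | t ∈ Set.Icc 0 4 ∧ Summable fun n => directedSingularValue t (r n)})) 4 := by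
  obtain ⟨M, hM⟩ := hr.exists_norm_le
  have hM' : ∀ n, (r n).1 ≤ M ∧ (r n).2 ≤ M := by
    intro n
    have h := hM _ (Set.mem_range_self n)
    exact ⟨(le_abs_self _).trans ((norm_fst_le (r n)).trans h),
      (le_abs_self _).trans ((norm_snd_le (r n)).trans h)⟩
  set T : Set ℝ := {t : ℝ | t ∈ Set.Icc 0 4 ∧ Summable fun n => directedSingularValue t (r n)}
  -- Rational exponents keep the exceptional sets countable in number. A rational below the infimum
  -- lies outside `T`, so monotonicity of the series in `t` plays no role.
  have hlow : ∀ᵐ ω ∂(Heisenberg.uniformSequenceLaw W), ∀ q : ℚ, (q : ℝ) ∈ Set.Icc (0 : ℝ) 4 →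
      (q : ℝ) ∉ T → ENNReal.ofReal q ≤ dimH (Heisenberg.limsupSet r ω) := by
    refine ae_all_iff.2 fun q => ?_
    by_cases hq : (q : ℝ) ∈ Set.Icc (0 : ℝ) 4 ∧ (q : ℝ) ∉ T
    · filter_upwards [Heisenberg.ae_le_dimH_limsupSet hne hopen hbdd hpos hM' hq.1.1 hq.1.2
        fun hs => hq.2 ⟨hq.1, hs⟩] with ω hω _ _ using hω
    · exact Filter.Eventually.of_forall fun ω h1 h2 => absurd ⟨h1, h2⟩ hq
  filter_upwards [hlow] with ω hω
  refine le_antisymm (le_min (le_sInf ?_) (Heisenberg.dimH_le_four _)) ?_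
  · rintro _ ⟨t, ht, rfl⟩
    exact Heisenberg.dimH_limsupSet_le ht.1.1 ht.1.2 hpos ht.2 ω
  · refine le_of_forall_lt fun d hd => ?_
    obtain ⟨q, hq0, hdq, hq⟩ := ENNReal.lt_iff_exists_rat_btwn.1 hd
    have hqr : (0 : ℝ) ≤ q := by exact_mod_cast hq0
    have hq4 : ENNReal.ofReal q < ENNReal.ofReal 4 := by
      rw [ENNReal.ofReal_ofNat]; exact hq.trans_le (min_le_right _ _)
    refine hdq.trans_le (hω q ⟨hqr, ((ENNReal.ofReal_lt_ofReal_iff (by norm_num)).1 hq4).le⟩ ?_)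
    intro hqT
    exact (hq.trans_le (min_le_left _ _)).not_ge (sInf_le ⟨q, hqT, rfl⟩)
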